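/- Let $S^2\subset\mathbb R^3$ be the unit sphere with its round metric, oriented so that the rotation by $90^\circ$ in the tangent planes is $\iota_x v=-x\times v$ (inward normal), and let $\sigma_x(u,w)=\langle \iota_x u,w\rangle$ be its area form. Identify $TS^2=\{(x,v): |x|=1,\ \langle x,v\rangle=0\}$ and let $\pi(x,v)=x$, $\alpha_{(x,v)}(\xi)=\langle v,d\pi\,\xi\rangle$, and $\omega_s=d\alpha-s\,\pi^*\sigma$ for $s\in\mathbb R$. For $\lambda>0$ let $D_\lambda S^2=\{(x,v)\in TS^2: |v|<\lambda\}$, and let $\Delta\subset S^2\times S^2$ be the diagonal. The group $\mathrm{SO}(3)$ acts on $D_\lambda S^2$ by $g(x,v)=(gx,gv)$ and diagonally on $S^2\times S^2$. **Theorem.** For all $s\in\mathbb R$ and $\lambda>0$ there are unique $R_1,R_2>0$ with $$s=R_2-R_1,\qquad \lambda=2\sqrt{R_1R_2},$$ and for these there is an $\mathrm{SO}(3)$-equivariant symplectomorphism $$F:(D_\lambda S^2,\omega_s)\to (S^2\times S^2\setminus\Delta,\ R_1\sigma\oplus R_2\sigma).$$ Identify $\mathfrak{so}(3)$ with $\mathbb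 R^3$ through $\xi\mapsto(x\mapsto\xi\times x)$ and call $\mu$ a moment map of the action if $\omega(\rho(\xi),\cdot)=-d\langle\mu,\xi\rangle$ for all $\xi$, where $\rho(\xi)$ is the vector field generated by $\xi$. Then $\mu_{D_\lambda S^2}(x,v)=x\times v-sx$ and $\mu_{S^2\times S^2}(N,S)=R_1N+R_2S$ are moment maps of the two actions, and $F$ intertwines them: $\mu_{S^2\times S^2}\circ F=\mu_{D_\lambda S^2}$. Moreover there are smooth even functions $c_1,c_2:(-\lambda,\lambda)\to(0,\infty)$ with $$R_1\sin(c_1(r)r)+R_2\sin(c_2(r)r)=r,\qquad R_1\cos(c_1(r)r)-R_2\cos(c_2(r)r)=R_1-R_2\qquad(|r|<\lambda)$$ such that $$F(x,v)=\bigl(\gamma_{(x,-\iota_x v)}(c_1(|v|)),\ \gamma_{(-x,-\iota_{-x}(-v))}(c_2(|v|))\bigr),$$ where $\gamma_{(y,w)}$ is the geodesic of $S^2$ with $\gamma_{(y,w)}(0)=y$ and $\dot\gamma_{(y,w)}(0)=w$. The same holds for the opposite orientation of $S^2$ ($\iota_x v=x\times v$), with the moment maps $x\times v+sx$ and $-(R_1N+R_2S)$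 instead. -/

import Mathlib

open scoped ContDiff

noncomputable section

namespace MagneticSphere

/-! ### Submanifolds of a normed space

A submanifold `M` of a normed space `V` is given by its underlying set together with the tangent
spaces `TM p ⊆ V` at its points; a two-form is given by its values `ω p a b` on tangent vectors. -/

section General

variable {V W : Type*} [NormedAddCommGroup V] [NormedSpace ℝ V]
  [NormedAddCommGroup W] [NormedSpace ℝ W]

/-- Smoothness of a map on a subset of a normed space: near every point of the subset, the map is
the restriction of a smooth map defined on an open subset of the ambient space. -/
def SmoothOnSubset (f : V → W) (M : Set V) : Prop :=
  ∀ p ∈ M, ∃ U : Set V, IsOpen U ∧ p ∈ U ∧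
    ∃ g : V → W, ContDiffOn ℝ ∞ g U ∧ ∀ q ∈ M ∩ U, f q = g q

/-- `F` restricts to a symplectomorphism `(M, ωM) → (N, ωN)`: it maps `M` bijectively onto `N`,
it is smooth with smooth inverse, and `F^* ωN = ωM`. The differential of `F` at a point `p` of `M`
is the restriction to `TM p` of any derivative `L` of `F` at `p` along `M` (these derivatives
agree on the vectors that are tangent to `M`). -/
structure IsSymplectomorphism (M : Set V) (TM : V → Set V) (ωM : V → V → V → ℝ)
    (N : Set W) (TN : W → Set W) (ωN : W → W → W → ℝ) (F : V → W) : Prop where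
  bijOn : Set.BijOn F M N
  smooth : SmoothOnSubset F M
  smooth_inverse : ∃ G : W → V, SmoothOnSubset G N ∧ Set.InvOn G F M N
  pullback : ∀ p ∈ M, ∃ L : V →L[ℝ] W, HasFDerivWithinAt F L M p ∧
    (∀ a ∈ TM p, L a ∈ TN (F p)) ∧
    ∀ a ∈ TM p, ∀ b ∈ TM p, ωN (F p) (L a) (L b) = ωM p a b

end General

/-! ### The sphere in three-space -/

/-- Euclidean three-space. -/
abbrev E3 : Type := EuclideanSpace ℝ (Fin 3)

/-- The unit sphere. -/
abbrev S2 : Set E3 := Metric.sphere (0 : E3) 1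

/-- The cross product of three-space. -/
def cross (u w : E3) : E3 := WithLp.toLp 2 (crossProduct (WithLp.ofLp u) (WithLp.ofLp w))

/-- The rotation by a right angle in the tangent plane of the sphere at `x`, that is, the complex
structure of the sphere. The sign `ε = 1` belongs to the orientation with `-ι_x v = x × v` (inward
normal), the sign `ε = -1` to the one with `ι_x v = x × v` (outward normal). -/
def iota (ε : ℝ) (x v : E3) : E3 := ε • cross v x

/-- The area form of the sphere for the orientation given by `ε`: `σ_x(u, w) = ⟨ι_x u, w⟩`. -/
def area (ε : ℝ) (x u w : E3) : ℝ := inner ℝ (iota ε x u) w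

/-- `γ` is a geodesic of the sphere, parametrized on the whole line: a smooth curve in the sphere
whose covariant acceleration, the tangential part of its second derivative, vanishes. -/
def IsGeodesic (γ : ℝ → E3) : Prop :=
  ContDiff ℝ ∞ γ ∧ (∀ t, γ t ∈ S2) ∧
    ∀ t, ∀ w : E3, inner ℝ (γ t) w = 0 → inner ℝ (deriv (deriv γ) t) w = 0

/-- `y = γ(t)` for the geodesic `γ` of the sphere that starts at `x` with velocity `w`; in other
words, `y` is the base point of the image of `(x, w)` under the time-`t` geodesic flow. -/
def IsGeodesicPoint (x w : E3) (t : ℝ) (y : E3) : Prop :=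
  ∃ γ : ℝ → E3, IsGeodesic γ ∧ γ 0 = x ∧ deriv γ 0 = w ∧ γ t = y

/-! ### The twisted disc bundle -/

/-- The open disc bundle of radius `lam` in the tangent bundle of the sphere. -/
def discBundle (lam : ℝ) : Set (E3 × E3) :=
  {p | p.1 ∈ S2 ∧ inner ℝ p.1 p.2 = 0 ∧ ‖p.2‖ < lam}

/-- The tangent space at `p` of the tangent bundle `{(x, v) : |x| = 1, ⟨x, v⟩ = 0}`. -/
def discTangent (p : E3 × E3) : Set (E3 × E3) :=
  {a | inner ℝ p.1 a.1 = 0 ∧ inner ℝ p.1 a.2 + inner ℝ a.1 p.2 = 0}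

/-- The canonical one-form `α_(x,v)(a) = ⟨v, dπ a⟩`, where `π (x, v) = x`. It is written on the
whole of `E3 × E3`; the form on the tangent bundle is its restriction. -/
def canonicalForm (p : E3 × E3) : (E3 × E3) [⋀^Fin 1]→L[ℝ] ℝ :=
  ContinuousAlternatingMap.ofSubsingleton ℝ (E3 × E3) ℝ (0 : Fin 1)
    ((innerSL ℝ p.2).comp (ContinuousLinearMap.fst ℝ E3 E3))

/-- The twisted form `ω_s = dα - s π^*σ` on the tangent bundle (the exterior derivative commutes
with the restriction to the tangent bundle). -/
def twistedForm (ε s : ℝ) (p a b : E3 × E3) : ℝ :=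
  extDeriv canonicalForm p ![a, b] - s * area ε p.1 a.1 b.1

/-! ### The product of two spheres without the diagonal -/

/-- The product of two spheres without the diagonal. -/
def pairs : Set (E3 × E3) := {q | q.1 ∈ S2 ∧ q.2 ∈ S2 ∧ q.1 ≠ q.2}

/-- The tangent space of the product of two spheres at `q`. -/
def pairsTangent (q : E3 × E3) : Set (E3 × E3) :=
  {a | inner ℝ q.1 a.1 = 0 ∧ inner ℝ q.2 a.2 = 0}

/-- The split form `R₁σ ⊕ R₂σ`. -/
def splitForm (ε R₁ R₂ : ℝ) (q a b : E3 × E3) : ℝ :=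
  R₁ * area ε q.1 a.1 b.1 + R₂ * area ε q.2 a.2 b.2

/-! ### The actions of the rotation group and their moment maps -/

/-- The rotation group. -/
abbrev SO3 : Type := Matrix.specialOrthogonalGroup (Fin 3) ℝ

/-- The action of a rotation on three-space. -/
def rotate (A : SO3) (x : E3) : E3 := WithLp.toLp 2 ((A : Matrix (Fin 3) (Fin 3) ℝ).mulVec x.ofLp)

/-- The action of a rotation on pairs of vectors. It is the action on the tangent bundle of the
sphere, `(x, v) ↦ (A x, dA_x v)`, and the diagonal action on the product of two spheres. -/
def act (A : SO3) (p : E3 × E3) : E3 × E3 := (rotate A p.1, rotate A p.2)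

/-- The vector field on pairs that is generated by the element `ξ` of the Lie algebra of the
rotation group, identified with three-space through `ξ ↦ (x ↦ ξ × x)`. -/
def generator (ξ : E3) (p : E3 × E3) : E3 × E3 := (cross ξ p.1, cross ξ p.2)

/-- `μ` is a moment map of the rotation action on `(M, Ω)`:
`Ω(ρ(ξ), ·) = -d⟨μ, ξ⟩` for all `ξ` in the Lie algebra. -/
def IsMomentMap (M : Set (E3 × E3)) (TM : E3 × E3 → Set (E3 × E3))
    (Ω : E3 × E3 → E3 × E3 → E3 × E3 → ℝ) (μ : E3 × E3 → E3) : Prop :=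
  ∀ ξ : E3, ∀ p ∈ M, ∀ a ∈ TM p,
    Ω p (generator ξ p) a = - fderiv ℝ (fun q => inner ℝ (μ q) ξ) p a

/-- The moment map of the twisted disc bundle; it is `x × v - s x` for `ε = 1`. -/
def discMoment (ε s : ℝ) (p : E3 × E3) : E3 := cross p.1 p.2 - (ε * s) • p.1

/-- The moment map of the product of two spheres; it is `R₁ N + R₂ S` for `ε = 1`. -/
def pairsMoment (ε R₁ R₂ : ℝ) (q : E3 × E3) : E3 := ε • (R₁ • q.1 + R₂ • q.2)

end MagneticSphere

end

open MagneticSphere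

/-!
The map `F` is written down explicitly. Let `r = ‖v‖`, let `θ / 2` be the angle with sine `r / lam`,
and let `k = cos (θ / 2)`, a smooth function of `v` on the open disc bundle. The two trigonometric
equations say that `R₁ exp (i a) - R₂ exp (-i b) = R₁ - R₂ + i r` for the angles `a = c₁ r` and
`b = c₂ r`. Taking absolute values gives `a + b = θ`, and then
`a, b = θ / 2 ± arctan ((R₂ - R₁) (r / lam) / (lam + (R₁ + R₂) k))`. These are odd analytic functions
of `r` near `0`, so the times `c₁`, `c₂` are smooth (`contDiffOn_time`); the numbers `cos a` and
`sin a / r` are rational functions of `k` (`cosCoeff`, `sinCoeff`, see `cos_angle` and `sin_angle`).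
Hence `F (x, v) = (N, S)`, where `N` and `S` are combinations of `x` and `x × v` whose coefficients
are rational in `k` (`toPairs`).

Conversely `⟨N, S⟩ = 1 - 2 k²`, so that `k` is determined by `(N, S)`; moreover `N × S` is a multiple
of `v`, and the linear system for `x` and `x × v` has determinant `2 k / lam ≠ 0`. This gives a
smooth inverse (`ofPairs`).

That `F` is symplectic is deduced from its symmetry. It is equivariant by construction, and the
trigonometric equations say exactly that it intertwines the moment maps (`pairsMoment_toPairs`). So
the pulled back form and the twisted form agree as soon as one argument is an infinitesimal rotation
(`splitForm_toPairsDeriv_generator`). Outside the zero section the orbits have codimension one, and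
two skew-symmetric forms that agree whenever one argument lies in a fixed hyperplane are equal. On
the zero section the vertical vectors form a complement of the orbit directions, and there both
forms vanish on pairs of vertical vectors, because `R₁ (sin a / r)² = R₂ (sin b / r)²` at `r = 0`
(`sinCoeff_one_sq`).
-/

namespace MagneticSphere

/-! ### The cross product -/

lemma inner_eq_coords (u w : E3) : inner ℝ u w = u 0 * w 0 + u 1 * w 1 + u 2 * w 2 := by
  simp [PiLp.inner_apply, Fin.sum_univ_three, mul_comm]

@[simp] lemma cross_apply_zero (u w : E3) : cross u w 0 = u 1 * w 2 - u 2 * w 1 := by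
  simp [cross, crossProduct]

@[simp] lemma cross_apply_one (u w : E3) : cross u w 1 = u 2 * w 0 - u 0 * w 2 := by
  simp [cross, crossProduct]

@[simp] lemma cross_apply_two (u w : E3) : cross u w 2 = u 0 * w 1 - u 1 * w 0 := by
  simp [cross, crossProduct]

lemma E3_ext {u w : E3} (h₀ : u 0 = w 0) (h₁ : u 1 = w 1) (h₂ : u 2 = w 2) : u = w := by
  ext i
  fin_cases i <;> assumption

lemma cross_add_left (u u' w : E3) : cross (u + u') w = cross u w + cross u' w := by
  apply E3_ext <;> simp <;> ring

lemma cross_add_right (u w w' : E3) : cross u (w + w') = cross u w + cross u w' := by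
  apply E3_ext <;> simp <;> ring

lemma cross_smul_left (c : ℝ) (u w : E3) : cross (c • u) w = c • cross u w := by
  apply E3_ext <;> simp <;> ring

lemma cross_smul_right (c : ℝ) (u w : E3) : cross u (c • w) = c • cross u w := by
  apply E3_ext <;> simp <;> ring

lemma cross_anticomm (u w : E3) : cross w u = -cross u w := by
  apply E3_ext <;> simp <;> ring

lemma cross_self (u : E3) : cross u u = 0 := by
  apply E3_ext <;> simp <;> ring

lemma cross_jacobi (u v w : E3) :
    cross u (cross v w) = cross (cross u v) w + cross v (cross u w) := by
  apply E3_ext <;> simp <;> ring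

/-- Lagrange's formula for the triple product. -/
lemma cross_cross_right (u v w : E3) :
    cross u (cross v w) = (inner ℝ u w : ℝ) • v - (inner ℝ u v : ℝ) • w := by
  apply E3_ext <;> simp [inner_eq_coords] <;> ring

lemma cross_cross_left (u v w : E3) :
    cross (cross u v) w = (inner ℝ u w : ℝ) • v - (inner ℝ v w : ℝ) • u := by
  apply E3_ext <;> simp [inner_eq_coords] <;> ring

lemma inner_cross_cross (u v w z : E3) :
    inner ℝ (cross u v) (cross w z) =
      (inner ℝ u w * inner ℝ v z - inner ℝ u z * inner ℝ v w : ℝ) := by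
  simp [inner_eq_coords]; ring

@[simp] lemma inner_cross_self_left (u v : E3) : inner ℝ u (cross u v) = (0 : ℝ) := by
  simp [inner_eq_coords]; ring

@[simp] lemma inner_cross_self_right (u v : E3) : inner ℝ v (cross u v) = (0 : ℝ) := by
  simp [inner_eq_coords]; ring

/-- The cross product as a continuous bilinear map. -/
noncomputable def crossBilin : E3 →L[ℝ] E3 →L[ℝ] E3 :=
  (LinearMap.mk₂ ℝ cross cross_add_left cross_smul_left cross_add_right
    cross_smul_right).toContinuousBilinearMap

lemma crossBilin_apply (u w : E3) : crossBilin u w = cross u w := rfl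

lemma contDiff_cross {n : ℕ∞ω} : ContDiff ℝ n fun p : E3 × E3 => cross p.1 p.2 :=
  crossBilin.isBoundedBilinearMap.contDiff

lemma hasFDerivAt_cross (p : E3 × E3) :
    HasFDerivAt (fun q : E3 × E3 => cross q.1 q.2)
      (crossBilin.isBoundedBilinearMap.deriv p) p :=
  crossBilin.isBoundedBilinearMap.hasFDerivAt p

/-! ### Rotations -/

lemma rotate_add (A : SO3) (u w : E3) : rotate A (u + w) = rotate A u + rotate A w := by
  simp [rotate, Matrix.mulVec_add]

lemma rotate_smul (A : SO3) (c : ℝ) (u : E3) : rotate A (c • u) = c • rotate A u := by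
  simp [rotate, Matrix.mulVec_smul]

/-- A rotation equals its own cofactor matrix, and the cofactor matrix of `A` maps `u × w` to
`A u × A w`. -/
lemma cross_rotate (A : SO3) (u w : E3) :
    cross (rotate A u) (rotate A w) = rotate A (cross u w) := by
  have hA := Matrix.mem_specialOrthogonalGroup_iff.1 A.2
  obtain ⟨M, hM⟩ : ∃ M : Matrix (Fin 3) (Fin 3) ℝ, (A : Matrix (Fin 3) (Fin 3) ℝ) = M := ⟨_, rfl⟩
  rw [hM] at hA
  have hadj : M.adjugate = M.transpose := by
    have h1 : M * M.transpose = 1 := by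
      simpa [Matrix.star_eq_conjTranspose] using (Matrix.mem_orthogonalGroup_iff _ _).1 hA.1
    calc M.adjugate = M.adjugate * (M * M.transpose) := by rw [h1, mul_one]
      _ = M.transpose := by rw [← mul_assoc, Matrix.adjugate_mul, hA.2, one_smul, one_mul]
  have key : ∀ i j, M.adjugate j i = M i j := fun i j => by rw [hadj]; rfl
  simp only [Matrix.adjugate_fin_three] at key
  have k00 := key 0 0; have k01 := key 0 1; have k02 := key 0 2
  have k10 := key 1 0; have k11 := key 1 1; have k12 := key 1 2
  have k20 := key 2 0; have k21 := key 2 1; have k22 := key 2 2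
  simp at k00 k01 k02 k10 k11 k12 k20 k21 k22
  apply E3_ext <;> simp [rotate, Matrix.mulVec, dotProduct, Fin.sum_univ_three, hM]
  · rw [← k00, ← k01, ← k02]; ring
  · rw [← k10, ← k11, ← k12]; ring
  · rw [← k20, ← k21, ← k22]; ring

lemma norm_rotate (A : SO3) (u : E3) : ‖rotate A u‖ = ‖u‖ := by
  have hA := (Matrix.mem_orthogonalGroup_iff' _ _).1
    (Matrix.mem_specialOrthogonalGroup_iff.1 A.2).1
  have h : (inner ℝ (rotate A u) (rotate A u) : ℝ) = inner ℝ u u := by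
    simp only [EuclideanSpace.inner_eq_star_dotProduct, rotate, star_trivial]
    rw [Matrix.dotProduct_mulVec, Matrix.vecMul_mulVec]
    have hA' : (A : Matrix (Fin 3) (Fin 3) ℝ).transpose * (A : Matrix (Fin 3) (Fin 3) ℝ) = 1 := hA
    rw [hA', Matrix.vecMul_one]
  rw [real_inner_self_eq_norm_sq, real_inner_self_eq_norm_sq] at h
  exact (sq_eq_sq₀ (norm_nonneg _) (norm_nonneg _)).1 h

/-! ### Geodesics of the sphere -/

/-- The geodesics of the sphere are the great circles; for `w = 0` this formula gives the constant
curve. -/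
lemma isGeodesicPoint_greatCircle {x w : E3} (hx : x ∈ S2) (hxw : inner ℝ x w = (0 : ℝ)) (t : ℝ) :
    IsGeodesicPoint x w t
      (Real.cos (t * ‖w‖) • x + (Real.sin (t * ‖w‖) / ‖w‖) • w) := by
  have hx1 : (inner ℝ x x : ℝ) = 1 := by
    rw [real_inner_self_eq_norm_sq, mem_sphere_zero_iff_norm.1 hx]; norm_num
  set r := ‖w‖ with hr
  have hrw : (r / r) • w = w := by
    rcases eq_or_ne w 0 with rfl | hw
    · simp
    · rw [div_self (by simpa [hr] using hw), one_smul]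
  have d1 : ∀ t, HasDerivAt (fun t : ℝ => Real.cos (t * r) • x + (Real.sin (t * r) / r) • w)
      ((-Real.sin (t * r) * r) • x + Real.cos (t * r) • w) t := by
    intro t
    have hl : HasDerivAt (fun t : ℝ => t * r) r t := by simpa using (hasDerivAt_id t).mul_const r
    refine ((hl.cos.smul_const x).add ((hl.sin.div_const r).smul_const w)).congr_deriv ?_
    rw [mul_div_assoc, mul_smul _ (r / r), hrw]
  have d2 : ∀ t, HasDerivAt (fun t : ℝ => (-Real.sin (t * r) * r) • x + Real.cos (t * r) • w)
      (-(r ^ 2) • (Real.cos (t * r) • x + (Real.sin (t * r) / r) • w)) t := by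
    intro t
    have hl : HasDerivAt (fun t : ℝ => t * r) r t := by simpa using (hasDerivAt_id t).mul_const r
    refine (((hl.sin.neg.mul_const r).smul_const x).add (hl.cos.smul_const w)).congr_deriv ?_
    rw [smul_add, smul_smul, smul_smul]
    congr 2
    · ring
    · rcases eq_or_ne r 0 with h0 | h0
      · simp [h0]
      · field_simp
  have hd1 : deriv (fun t : ℝ => Real.cos (t * r) • x + (Real.sin (t * r) / r) • w) =
      fun t => (-Real.sin (t * r) * r) • x + Real.cos (t * r) • w := funext fun t => (d1 t).deriv
  refine ⟨fun t => Real.cos (t * r) • x + (Real.sin (t * r) / r) • w, ⟨?_, ?_, ?_⟩, ?_, ?_, rfl⟩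
  · fun_prop
  · intro t
    rw [mem_sphere_zero_iff_norm, ← sq_eq_sq₀ (norm_nonneg _) zero_le_one,
      ← real_inner_self_eq_norm_sq]
    simp only [inner_add_left, inner_add_right, real_inner_smul_left, real_inner_smul_right,
      hx1, hxw, real_inner_comm x w, real_inner_self_eq_norm_sq w, ← hr]
    rcases eq_or_ne r 0 with h0 | h0
    · simp [h0]
    · field_simp
      linear_combination r * Real.sin_sq_add_cos_sq (t * r)
  · intro t u hu
    rw [hd1, (d2 t).deriv, real_inner_smul_left, hu, mul_zero]
  · simp
  · rw [hd1]; simp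

/-! ### The forms and the moment maps -/

lemma extDeriv_canonicalForm (p a b : E3 × E3) :
    extDeriv canonicalForm p ![a, b] = inner ℝ a.2 b.1 - inner ℝ b.2 a.1 := by
  have hval : ∀ (q : E3 × E3) (v : Fin 1 → E3 × E3),
      canonicalForm q v = inner ℝ q.2 (v 0).1 := fun q v => rfl
  have hdiff : DifferentiableAt ℝ canonicalForm p := by
    have h : canonicalForm = fun q : E3 × E3 =>
        ContinuousAlternatingMap.ofSubsingletonLIE (𝕜 := ℝ) (E := E3 × E3) (F := ℝ) (0 : Fin 1)
          ((innerSL ℝ q.2).comp (ContinuousLinearMap.fst ℝ E3 E3)) := rfl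
    rw [h]
    refine (LinearIsometryEquiv.differentiable _).differentiableAt.comp p ?_
    exact ((innerSL ℝ (E := E3)).differentiableAt.comp p differentiableAt_snd).clm_comp
      (differentiableAt_const _)
  have hfd : ∀ c : E3, ∀ a : E3 × E3,
      fderiv ℝ (fun q : E3 × E3 => (inner ℝ q.2 c : ℝ)) p a = inner ℝ a.2 c := by
    intro c a
    rw [fderiv_inner_apply ℝ (by fun_prop) (by fun_prop)]
    simp [fderiv_snd]
  rw [extDeriv_apply hdiff]
  simp [Fin.sum_univ_two, hval, Fin.removeNth, hfd]
  ring

lemma twistedForm_eq (ε s : ℝ) (p a b : E3 × E3) :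
    twistedForm ε s p a b =
      inner ℝ a.2 b.1 - inner ℝ b.2 a.1 - s * (ε * inner ℝ (cross a.1 p.1) b.1) := by
  simp [twistedForm, extDeriv_canonicalForm, area, iota, real_inner_smul_left]

/-- The derivative of the moment map of the disc bundle, as a linear map. -/
noncomputable def discMomentDeriv (ε s : ℝ) (p : E3 × E3) : E3 × E3 →L[ℝ] E3 :=
  crossBilin.isBoundedBilinearMap.deriv p - (ε * s) • ContinuousLinearMap.fst ℝ E3 E3

lemma discMomentDeriv_apply (ε s : ℝ) (p a : E3 × E3) :
    discMomentDeriv ε s p a = cross p.1 a.2 + cross a.1 p.2 - (ε * s) • a.1 := rfl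

lemma hasFDerivAt_discMoment (ε s : ℝ) (p : E3 × E3) :
    HasFDerivAt (discMoment ε s) (discMomentDeriv ε s p) p :=
  (hasFDerivAt_cross p).sub (hasFDerivAt_fst.const_smul (ε * s))

/-- The moment map of the product of two spheres, which is linear. -/
noncomputable def pairsMomentCLM (ε R₁ R₂ : ℝ) : E3 × E3 →L[ℝ] E3 :=
  ε • (R₁ • ContinuousLinearMap.fst ℝ E3 E3 + R₂ • ContinuousLinearMap.snd ℝ E3 E3)

lemma pairsMomentCLM_apply (ε R₁ R₂ : ℝ) (q : E3 × E3) :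
    pairsMomentCLM ε R₁ R₂ q = pairsMoment ε R₁ R₂ q := rfl

lemma hasFDerivAt_pairsMoment (ε R₁ R₂ : ℝ) (p : E3 × E3) :
    HasFDerivAt (pairsMoment ε R₁ R₂) (pairsMomentCLM ε R₁ R₂) p :=
  (pairsMomentCLM ε R₁ R₂).hasFDerivAt

lemma fderiv_inner_const {f : E3 × E3 → E3} {f' : E3 × E3 →L[ℝ] E3} {p : E3 × E3}
    (hf : HasFDerivAt f f' p) (ξ : E3) (a : E3 × E3) :
    fderiv ℝ (fun q => (inner ℝ (f q) ξ : ℝ)) p a = inner ℝ (f' a) ξ := by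
  rw [fderiv_inner_apply ℝ hf.differentiableAt (by fun_prop), hf.fderiv]
  simp

lemma inner_cross_cross_self {x a : E3} (hx : x ∈ S2) (ha : inner ℝ x a = (0 : ℝ)) (ξ : E3) :
    inner ℝ (cross (cross ξ x) x) a = -(inner ℝ ξ a : ℝ) := by
  rw [cross_cross_left, inner_sub_left, real_inner_smul_left, real_inner_smul_left, ha,
    real_inner_self_eq_norm_sq, mem_sphere_zero_iff_norm.1 hx]
  ring

lemma twistedForm_generator {ε s : ℝ} {p a : E3 × E3} (hp : p.1 ∈ S2)
    (ha : inner ℝ p.1 a.1 = (0 : ℝ)) (ξ : E3) :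
    twistedForm ε s p (generator ξ p) a = -inner ℝ (discMomentDeriv ε s p a) ξ := by
  rw [twistedForm_eq, discMomentDeriv_apply]
  simp only [generator, inner_cross_cross_self hp ha]
  simp only [inner_sub_left, inner_add_left, real_inner_smul_left]
  simp [inner_eq_coords]
  ring

lemma splitForm_generator {ε R₁ R₂ : ℝ} {q a : E3 × E3} (hq₁ : q.1 ∈ S2) (hq₂ : q.2 ∈ S2)
    (ha : a ∈ pairsTangent q) (ξ : E3) :
    splitForm ε R₁ R₂ q (generator ξ q) a = -inner ℝ (pairsMoment ε R₁ R₂ a) ξ := by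
  simp only [splitForm, area, iota, generator, real_inner_smul_left,
    inner_cross_cross_self hq₁ ha.1, inner_cross_cross_self hq₂ ha.2, pairsMoment, inner_add_right,
    real_inner_smul_right, real_inner_comm ξ]
  ring

lemma isMomentMap_discMoment (ε s lam : ℝ) :
    IsMomentMap (discBundle lam) discTangent (twistedForm ε s) (discMoment ε s) := by
  intro ξ p hp a ha
  rw [fderiv_inner_const (hasFDerivAt_discMoment ε s p), twistedForm_generator hp.1 ha.1]

lemma isMomentMap_pairsMoment (ε R₁ R₂ : ℝ) :
    IsMomentMap pairs pairsTangent (splitForm ε R₁ R₂) (pairsMoment ε R₁ R₂) := by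
  intro ξ q hq a ha
  rw [fderiv_inner_const (hasFDerivAt_pairsMoment ε R₁ R₂ q), splitForm_generator hq.1 hq.2.1 ha,
    pairsMomentCLM_apply]

/-! ### The two radii -/

lemma existsUnique_radii {s lam : ℝ} (hlam : 0 < lam) :
    ∃! R : ℝ × ℝ, 0 < R.1 ∧ 0 < R.2 ∧ s = R.2 - R.1 ∧ lam = 2 * √(R.1 * R.2) := by
  have hroot : |s| < √(s ^ 2 + lam ^ 2) := by
    rw [← Real.sqrt_sq_eq_abs]
    exact Real.sqrt_lt_sqrt (sq_nonneg s) (by nlinarith)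
  have hsq : √(s ^ 2 + lam ^ 2) ^ 2 = s ^ 2 + lam ^ 2 := Real.sq_sqrt (by positivity)
  obtain ⟨h1, h2⟩ := abs_lt.1 hroot
  refine ⟨((√(s ^ 2 + lam ^ 2) - s) / 2, (√(s ^ 2 + lam ^ 2) + s) / 2),
    ⟨by simp only; linarith, by simp only; linarith, by simp only; ring, ?_⟩, ?_⟩
  · have : (√(s ^ 2 + lam ^ 2) - s) / 2 * ((√(s ^ 2 + lam ^ 2) + s) / 2) = (lam / 2) ^ 2 := by
      linear_combination hsq / 4
    simp only [this]
    rw [Real.sqrt_sq (by positivity)]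
    ring
  · rintro ⟨R₁, R₂⟩ ⟨hR₁, hR₂, rfl, rfl⟩
    have h : (R₂ - R₁) ^ 2 + (2 * √(R₁ * R₂)) ^ 2 = (R₁ + R₂) ^ 2 := by
      rw [mul_pow, Real.sq_sqrt (by simp only at *; positivity)]
      ring
    simp only at hR₁ hR₂
    rw [h, Real.sqrt_sq (by positivity)]
    ext <;> simp only <;> ring

/-! ### The coefficients of the map -/

/-- With `k = cos (θ / 2)`, where `sin (θ / 2) = r / lam`, this is `cos (c r)` for the time `c` that
belongs to the sphere of weight `R`; `R'` is the other weight. -/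
noncomputable def cosCoeff (lam R R' k : ℝ) : ℝ :=
  (lam * k + R - R' + 2 * R' * k ^ 2) / (R + R' + lam * k)

/-- With `k` as in `cosCoeff`, this is `sin (c r) / r`. -/
noncomputable def sinCoeff (lam R R' k : ℝ) : ℝ :=
  (lam + 2 * R' * k) / (lam * (R + R' + lam * k))

section Coefficients

variable {lam R R' k : ℝ}

lemma denom_pos (hlam : 0 < lam) (hR : 0 < R) (hR' : 0 < R') (hk : 0 ≤ k) :
    0 < R + R' + lam * k := by positivity

lemma cosCoeff_sq_add (hlam : 0 < lam) (hR : 0 < R) (hR' : 0 < R') (h : lam ^ 2 = 4 * (R * R'))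
    (hk : 0 ≤ k) :
    cosCoeff lam R R' k ^ 2 + sinCoeff lam R R' k ^ 2 * (lam ^ 2 * (1 - k ^ 2)) = 1 := by
  have hd := denom_pos hlam hR hR' hk
  unfold cosCoeff sinCoeff
  field_simp
  linear_combination (1 - k ^ 2) * h

lemma cosCoeff_mul_sub (hlam : 0 < lam) (hR : 0 < R) (hR' : 0 < R') (h : lam ^ 2 = 4 * (R * R'))
    (hk : 0 ≤ k) :
    cosCoeff lam R R' k * cosCoeff lam R' R k -
      sinCoeff lam R R' k * sinCoeff lam R' R k * (lam ^ 2 * (1 - k ^ 2)) = 2 * k ^ 2 - 1 := by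
  have hd := denom_pos hlam hR hR' hk
  have hd' := denom_pos hlam hR' hR hk
  unfold cosCoeff sinCoeff
  rw [add_comm R' R] at hd' ⊢
  field_simp
  linear_combination (k ^ 2 - 1 + 2 * k ^ 2 * (1 - k ^ 2)) * h

lemma cosCoeff_mul_sinCoeff_add (hlam : 0 < lam) (hR : 0 < R) (hR' : 0 < R')
    (h : lam ^ 2 = 4 * (R * R')) (hk : 0 ≤ k) :
    cosCoeff lam R R' k * sinCoeff lam R' R k + sinCoeff lam R R' k * cosCoeff lam R' R k =
      2 * k / lam := by
  have hd := denom_pos hlam hR hR' hk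
  have hd' := denom_pos hlam hR' hR hk
  unfold cosCoeff sinCoeff
  rw [add_comm R' R] at hd' ⊢
  field_simp
  linear_combination 2 * k * (1 - k ^ 2) * h

lemma cosCoeff_balance (hlam : 0 < lam) (hR : 0 < R) (hR' : 0 < R') (hk : 0 ≤ k) :
    R * cosCoeff lam R R' k - R' * cosCoeff lam R' R k = R - R' := by
  have hd := denom_pos hlam hR hR' hk
  have hd' := denom_pos hlam hR' hR hk
  unfold cosCoeff
  rw [add_comm R' R] at hd' ⊢
  field_simp
  ring

lemma sinCoeff_balance (hlam : 0 < lam) (hR : 0 < R) (hR' : 0 < R') (h : lam ^ 2 = 4 * (R * R'))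
    (hk : 0 ≤ k) :
    R * sinCoeff lam R R' k + R' * sinCoeff lam R' R k = 1 := by
  have hd := denom_pos hlam hR hR' hk
  have hd' := denom_pos hlam hR' hR hk
  unfold sinCoeff
  rw [add_comm R' R] at hd' ⊢
  field_simp
  linear_combination -k * h

lemma sinCoeff_sub_sinCoeff (hlam : 0 < lam) (hR : 0 < R) (hR' : 0 < R') (hk : 0 ≤ k) :
    sinCoeff lam R R' k * (1 - 2 * k ^ 2) - sinCoeff lam R' R k =
      -(2 * k / lam) * cosCoeff lam R R' k := by
  have hd := denom_pos hlam hR hR' hk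
  have hd' := denom_pos hlam hR' hR hk
  unfold cosCoeff sinCoeff
  rw [add_comm R' R] at hd' ⊢
  field_simp
  ring

lemma cosCoeff_one (hlam : 0 < lam) (hR : 0 < R) (hR' : 0 < R') : cosCoeff lam R R' 1 = 1 := by
  have hd := denom_pos hlam hR hR' zero_le_one
  unfold cosCoeff
  field_simp
  ring

lemma sinCoeff_one_sq (hlam : 0 < lam) (hR : 0 < R) (hR' : 0 < R') (h : lam ^ 2 = 4 * (R * R')) :
    R * sinCoeff lam R R' 1 ^ 2 = R' * sinCoeff lam R' R 1 ^ 2 := by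
  have hd := denom_pos hlam hR hR' zero_le_one
  have hd' := denom_pos hlam hR' hR zero_le_one
  unfold sinCoeff
  rw [add_comm R' R] at hd' ⊢
  field_simp
  linear_combination (R - R') * h

lemma contDiffAt_cosCoeff (hlam : 0 < lam) (hR : 0 < R) (hR' : 0 < R') (hk : 0 ≤ k) {n : ℕ∞ω} :
    ContDiffAt ℝ n (cosCoeff lam R R') k := by
  have hd := (denom_pos hlam hR hR' hk).ne'
  unfold cosCoeff
  fun_prop (disch := assumption)

lemma contDiffAt_sinCoeff (hlam : 0 < lam) (hR : 0 < R) (hR' : 0 < R') (hk : 0 ≤ k) {n : ℕ∞ω} :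
    ContDiffAt ℝ n (sinCoeff lam R R') k := by
  have hd := (mul_pos hlam (denom_pos hlam hR hR' hk)).ne'
  unfold sinCoeff
  fun_prop (disch := assumption)

end Coefficients

/-! ### The times of the geodesic flow -/

/-- The cosine of the angle with sine `r / lam`. -/
noncomputable def halfCos (lam r : ℝ) : ℝ := √(1 - (r / lam) ^ 2)

/-- The angle `c r`, where `c` is the time that belongs to the sphere of weight `R`. -/
noncomputable def angle (lam R R' r : ℝ) : ℝ :=
  Real.arcsin (r / lam) +
    Real.arctan ((R' - R) * (r / lam) / (lam + (R + R') * halfCos lam r))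

/-- The time `c = angle / r`, extended smoothly to `r = 0`. -/
noncomputable def time (lam R R' : ℝ) : ℝ → ℝ := dslope (angle lam R R') 0

section Times

variable {lam R R' r : ℝ}

lemma one_sub_div_sq_pos (hlam : 0 < lam) (hr : r ∈ Set.Ioo (-lam) lam) :
    0 < 1 - (r / lam) ^ 2 := by
  rw [sub_pos, sq_lt_one_iff_abs_lt_one, abs_div, abs_of_pos hlam, div_lt_one hlam]
  exact abs_lt.2 hr

lemma halfCos_pos (hlam : 0 < lam) (hr : r ∈ Set.Ioo (-lam) lam) : 0 < halfCos lam r :=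
  Real.sqrt_pos.2 (one_sub_div_sq_pos hlam hr)

lemma halfCos_nonneg : 0 ≤ halfCos lam r := Real.sqrt_nonneg _

lemma halfCos_neg : halfCos lam (-r) = halfCos lam r := by
  unfold halfCos
  rw [neg_div, neg_sq]

lemma halfCos_zero : halfCos lam 0 = 1 := by simp [halfCos]

lemma halfCos_sq (hlam : 0 < lam) (hr : r ∈ Set.Ioo (-lam) lam) :
    halfCos lam r ^ 2 = 1 - (r / lam) ^ 2 :=
  Real.sq_sqrt (one_sub_div_sq_pos hlam hr).le

lemma sq_eq_of_halfCos (hlam : 0 < lam) (hr : r ∈ Set.Ioo (-lam) lam) :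
    r ^ 2 = lam ^ 2 * (1 - halfCos lam r ^ 2) := by
  rw [halfCos_sq hlam hr]
  field_simp
  ring

lemma contDiffAt_halfCos (hlam : 0 < lam) (hr : r ∈ Set.Ioo (-lam) lam) {n : ℕ∞ω} :
    ContDiffAt ℝ n (halfCos lam) r := by
  have h := (one_sub_div_sq_pos hlam hr).ne'
  unfold halfCos
  exact ContDiffAt.sqrt (by fun_prop) h

lemma sqrt_one_add_sq (hlam : 0 < lam) (hR : 0 < R) (hR' : 0 < R') (h : lam ^ 2 = 4 * (R * R'))
    (hr : r ∈ Set.Ioo (-lam) lam) :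
    √(1 + ((R' - R) * (r / lam) / (lam + (R + R') * halfCos lam r)) ^ 2) =
      (R + R' + lam * halfCos lam r) / (lam + (R + R') * halfCos lam r) := by
  have hk := halfCos_pos hlam hr
  have hs : (r / lam) ^ 2 = 1 - halfCos lam r ^ 2 := by rw [halfCos_sq hlam hr]; ring
  rw [Real.sqrt_eq_iff_eq_sq (by positivity) (by positivity), div_pow, mul_pow, hs]
  field_simp
  linear_combination (1 - halfCos lam r ^ 2) * h

lemma sin_angle (hlam : 0 < lam) (hR : 0 < R) (hR' : 0 < R') (h : lam ^ 2 = 4 * (R * R'))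
    (hr : r ∈ Set.Ioo (-lam) lam) :
    Real.sin (angle lam R R' r) = sinCoeff lam R R' (halfCos lam r) * r := by
  have hk := halfCos_pos hlam hr
  have hs := abs_le.1 (sq_le_one_iff_abs_le_one _ |>.1 (sub_pos.1 (one_sub_div_sq_pos hlam hr)).le)
  unfold angle
  rw [Real.sin_add, Real.sin_arcsin hs.1 hs.2, Real.cos_arcsin, Real.cos_arctan, Real.sin_arctan,
    sqrt_one_add_sq hlam hR hR' h hr, ← halfCos]
  unfold sinCoeff
  field_simp
  ring

lemma cos_angle (hlam : 0 < lam) (hR : 0 < R) (hR' : 0 < R') (h : lam ^ 2 = 4 * (R * R'))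
    (hr : r ∈ Set.Ioo (-lam) lam) :
    Real.cos (angle lam R R' r) = cosCoeff lam R R' (halfCos lam r) := by
  have hk := halfCos_pos hlam hr
  have hsq : (r / lam) ^ 2 = 1 - halfCos lam r ^ 2 := by rw [halfCos_sq hlam hr]; ring
  have hs := abs_le.1 (sq_le_one_iff_abs_le_one _ |>.1 (sub_pos.1 (one_sub_div_sq_pos hlam hr)).le)
  unfold angle
  rw [Real.cos_add, Real.sin_arcsin hs.1 hs.2, Real.cos_arcsin, Real.cos_arctan, Real.sin_arctan,
    sqrt_one_add_sq hlam hR hR' h hr, ← halfCos]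
  unfold cosCoeff
  generalize r / lam = ρ at *
  field_simp
  linear_combination (R - R') * hsq

lemma angle_zero : angle lam R R' 0 = 0 := by simp [angle]

lemma angle_neg : angle lam R R' (-r) = -angle lam R R' r := by
  simp only [angle, halfCos_neg, neg_div, Real.arcsin_neg, mul_neg, Real.arctan_neg]
  ring

lemma contDiffAt_angle (hlam : 0 < lam) (hR : 0 < R) (hR' : 0 < R')
    (hr : r ∈ Set.Ioo (-lam) lam) {n : ℕ∞ω} : ContDiffAt ℝ n (angle lam R R') r := by
  have hk := halfCos_pos hlam hr
  have hd : lam + (R + R') * halfCos lam r ≠ 0 := by positivity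
  have hsq := one_sub_div_sq_pos hlam hr
  have hc := contDiffAt_halfCos (n := n) hlam hr
  refine ContDiffAt.add ?_ ?_
  · refine (Real.contDiffAt_arcsin ?_ ?_).comp r (by fun_prop)
    · intro h; rw [h] at hsq; norm_num at hsq
    · intro h; rw [h] at hsq; norm_num at hsq
  · exact Real.contDiff_arctan.contDiffAt.comp r
      (ContDiffAt.div (by fun_prop) (by fun_prop) hd)

lemma time_mul_self : time lam R R' r * r = angle lam R R' r := by
  have := sub_smul_dslope (angle lam R R') 0 r
  rw [angle_zero, sub_zero, sub_zero, smul_eq_mul, mul_comm] at this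
  exact this

lemma time_neg : time lam R R' (-r) = time lam R R' r := by
  rcases eq_or_ne r 0 with rfl | h
  · rw [neg_zero]
  · have h1 := time_mul_self (lam := lam) (R := R) (R' := R') (r := -r)
    rw [angle_neg, ← time_mul_self, mul_neg, neg_inj] at h1
    exact mul_right_cancel₀ h h1

/-- Away from `0` the time is a quotient of smooth functions; at `0` it is the divided difference of
an analytic function, hence analytic. -/
lemma contDiffOn_time (hlam : 0 < lam) (hR : 0 < R) (hR' : 0 < R') :
    ContDiffOn ℝ ∞ (time lam R R') (Set.Ioo (-lam) lam) := by
  intro r hr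
  refine ContDiffAt.contDiffWithinAt ?_
  rcases eq_or_ne r 0 with rfl | h
  · obtain ⟨p, hp⟩ := (contDiffAt_angle (n := ω) hlam hR hR' hr).analyticAt
    exact AnalyticAt.contDiffAt ⟨_, hp.has_fpower_series_dslope_fslope⟩
  · have h1 : ContDiffAt ℝ ∞ (fun t => angle lam R R' t / t) r :=
      (contDiffAt_angle hlam hR hR' hr).div contDiffAt_id h
    refine h1.congr_of_eventuallyEq ?_
    filter_upwards [isOpen_ne.mem_nhds h] with t ht
    rw [← time_mul_self, mul_div_cancel_right₀ _ ht]

lemma angle_pos (hlam : 0 < lam) (hR : 0 < R) (hR' : 0 < R') (hr : r ∈ Set.Ioo (-lam) lam)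
    (hr0 : 0 < r) : 0 < angle lam R R' r := by
  have hk := halfCos_pos hlam hr
  have hsq := one_sub_div_sq_pos hlam hr
  have hρ : 0 < r / lam := by positivity
  have h1 : Real.arcsin (r / lam) = Real.arctan (r / lam / halfCos lam r) :=
    Real.arcsin_eq_arctan ⟨by nlinarith, by nlinarith⟩
  unfold angle
  rw [h1, ← neg_lt_iff_pos_add, ← Real.arctan_neg]
  apply Real.arctan_strictMono
  rw [← neg_div, div_lt_div_iff₀ (by positivity) hk]
  nlinarith [mul_pos hρ hlam, mul_pos hρ (mul_pos hR' hk)]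

lemma time_zero_pos (hlam : 0 < lam) (hR : 0 < R) (hR' : 0 < R') (h : lam ^ 2 = 4 * (R * R')) :
    0 < time lam R R' 0 := by
  have h0 : (0 : ℝ) ∈ Set.Ioo (-lam) lam := ⟨by linarith, hlam⟩
  have hd : HasDerivAt (angle lam R R') (time lam R R' 0) 0 := by
    rw [time, dslope_same]
    exact ((contDiffAt_angle (n := 1) hlam hR hR' h0).differentiableAt one_ne_zero).hasDerivAt
  -- both sides of `sin_angle` are differentiated at `0`
  have hd1 : HasDerivAt (fun r => Real.sin (angle lam R R' r)) (time lam R R' 0) 0 := by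
    simpa [angle_zero] using hd.sin
  have hs : DifferentiableAt ℝ (fun r => sinCoeff lam R R' (halfCos lam r)) 0 :=
    ((contDiffAt_sinCoeff hlam hR hR' halfCos_nonneg (n := 1)).differentiableAt
      one_ne_zero).comp 0 ((contDiffAt_halfCos hlam h0 (n := 1)).differentiableAt one_ne_zero)
  have hd2 : HasDerivAt (fun r => sinCoeff lam R R' (halfCos lam r) * r)
      (sinCoeff lam R R' 1) 0 := by
    exact (hs.hasDerivAt.mul (hasDerivAt_id' (0 : ℝ))).congr_deriv (by simp [halfCos_zero])
  have heq : (fun r => Real.sin (angle lam R R' r)) =ᶠ[nhds 0]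
      fun r => sinCoeff lam R R' (halfCos lam r) * r := by
    filter_upwards [isOpen_Ioo.mem_nhds h0] with r hr using sin_angle hlam hR hR' h hr
  rw [hd1.unique (hd2.congr_of_eventuallyEq heq)]
  unfold sinCoeff
  positivity

lemma time_pos (hlam : 0 < lam) (hR : 0 < R) (hR' : 0 < R') (h : lam ^ 2 = 4 * (R * R'))
    (hr : r ∈ Set.Ioo (-lam) lam) : 0 < time lam R R' r := by
  have hpos : ∀ t ∈ Set.Ioo (-lam) lam, 0 < t → 0 < time lam R R' t := fun t ht ht0 =>
    pos_of_mul_pos_left (time_mul_self (lam := lam) (R := R) (R' := R') (r := t) ▸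
      angle_pos hlam hR hR' ht ht0) ht0.le
  rcases lt_trichotomy r 0 with h0 | rfl | h0
  · rw [← time_neg]
    exact hpos _ ⟨by linarith [hr.2], by linarith [hr.1]⟩ (by linarith)
  · exact time_zero_pos hlam hR hR' h
  · exact hpos r hr h0

end Times

/-! ### The map to the product of two spheres -/

lemma inner_self_of_mem_S2 {x : E3} (hx : x ∈ S2) : inner ℝ x x = (1 : ℝ) := by
  rw [real_inner_self_eq_norm_sq, mem_sphere_zero_iff_norm.1 hx, one_pow]

lemma mem_S2_of_inner_self {x : E3} (hx : inner ℝ x x = (1 : ℝ)) : x ∈ S2 := by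
  rw [real_inner_self_eq_norm_sq] at hx
  exact mem_sphere_zero_iff_norm.2 ((pow_eq_one_iff_of_nonneg (norm_nonneg _) two_ne_zero).1 hx)

/-- The end point of the geodesic that starts at `x` with velocity `ε x × v` and runs for the time
`time lam R R' ‖v‖`, written without trigonometric functions so that it extends smoothly to all
`(x, v)` with `‖v‖ < lam`. -/
noncomputable def arc (ε lam R R' : ℝ) (p : E3 × E3) : E3 :=
  cosCoeff lam R R' (halfCos lam ‖p.2‖) • p.1 +
    (ε * sinCoeff lam R R' (halfCos lam ‖p.2‖)) • cross p.1 p.2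

/-- The map from the disc bundle to the product of two spheres. -/
noncomputable def toPairs (ε lam R₁ R₂ : ℝ) (p : E3 × E3) : E3 × E3 :=
  (arc ε lam R₁ R₂ p, arc ε lam R₂ R₁ (-p))

/-- For `q = toPairs ε lam R₁ R₂ p` this is `halfCos lam ‖p.2‖`, since the angle between the two
components of `q` is `π` minus the sum of the two geodesic angles. -/
noncomputable def pairCos (q : E3 × E3) : ℝ := √((1 - inner ℝ q.1 q.2) / 2)

/-- The inverse of `toPairs`. -/
noncomputable def ofPairs (ε lam R₁ R₂ : ℝ) (q : E3 × E3) : E3 × E3 :=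
  ((lam / (2 * pairCos q)) •
      (sinCoeff lam R₂ R₁ (pairCos q) • q.1 - sinCoeff lam R₁ R₂ (pairCos q) • q.2),
    (-(ε * (lam / (2 * pairCos q)))) • cross q.1 q.2)

section Map

variable {ε lam R R' : ℝ} {p : E3 × E3}

lemma norm_mem_Ioo (hp : ‖p.2‖ < lam) : ‖p.2‖ ∈ Set.Ioo (-lam) lam :=
  ⟨by linarith [norm_nonneg p.2], hp⟩

lemma neg_mem_discBundle (hp : p ∈ discBundle lam) : -p ∈ discBundle lam := by
  simpa [discBundle] using hp

lemma cross_neg_neg (u w : E3) : cross (-u) (-w) = cross u w := by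
  apply E3_ext <;> simp

lemma arc_neg : arc ε lam R R' (-p) =
    -(cosCoeff lam R R' (halfCos lam ‖p.2‖) • p.1) +
    (ε * sinCoeff lam R R' (halfCos lam ‖p.2‖)) • cross p.1 p.2 := by
  simp [arc, cross_neg_neg]

lemma inner_arc_self (hε : ε ^ 2 = 1) (hR : 0 < R) (hR' : 0 < R') (h : lam ^ 2 = 4 * (R * R'))
    (hp : ‖p.2‖ < lam) :
    inner ℝ (arc ε lam R R' p) (arc ε lam R R' p) =
      inner ℝ p.1 p.1 - (sinCoeff lam R R' (halfCos lam ‖p.2‖) * inner ℝ p.1 p.2 : ℝ) ^ 2 := by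
  have hlam : 0 < lam := (norm_nonneg _).trans_lt hp
  have h1 := cosCoeff_sq_add hlam hR hR' h (halfCos_nonneg (lam := lam) (r := ‖p.2‖))
  have h2 := sq_eq_of_halfCos hlam (norm_mem_Ioo hp)
  rw [← h2] at h1
  simp only [arc, inner_add_left, inner_add_right, real_inner_smul_left, real_inner_smul_right,
    inner_cross_cross, inner_cross_self_left, real_inner_comm p.1 (cross p.1 p.2)]
  rw [real_inner_self_eq_norm_sq p.2, real_inner_comm p.1 p.2]
  linear_combination (inner ℝ p.1 p.1 : ℝ) * h1 + (sinCoeff lam R R' (halfCos lam ‖p.2‖)) ^ 2 *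
    ((inner ℝ p.1 p.1 : ℝ) * ‖p.2‖ ^ 2 - (inner ℝ p.1 p.2 : ℝ) ^ 2) * hε

lemma arc_mem_S2 (hε : ε ^ 2 = 1) (hR : 0 < R) (hR' : 0 < R') (h : lam ^ 2 = 4 * (R * R'))
    (hp : p ∈ discBundle lam) : arc ε lam R R' p ∈ S2 := by
  apply mem_S2_of_inner_self
  rw [inner_arc_self hε hR hR' h hp.2.2, inner_self_of_mem_S2 hp.1, hp.2.1]
  ring

lemma inner_arc_arc_neg (hε : ε ^ 2 = 1) (hR : 0 < R) (hR' : 0 < R') (h : lam ^ 2 = 4 * (R * R'))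
    (hp : p ∈ discBundle lam) :
    inner ℝ (arc ε lam R R' p) (arc ε lam R' R (-p)) = 1 - 2 * halfCos lam ‖p.2‖ ^ 2 := by
  have hlam : 0 < lam := (norm_nonneg _).trans_lt hp.2.2
  have h1 := cosCoeff_mul_sub hlam hR hR' h (halfCos_nonneg (lam := lam) (r := ‖p.2‖))
  have h2 := sq_eq_of_halfCos hlam (norm_mem_Ioo hp.2.2)
  rw [← h2] at h1
  rw [arc_neg]
  simp only [arc, inner_add_left, inner_add_right, real_inner_smul_left, real_inner_smul_right,
    inner_cross_cross, inner_cross_self_left, inner_neg_right]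
  rw [real_inner_self_eq_norm_sq p.2, real_inner_comm p.1 (cross p.1 p.2), inner_cross_self_left,
    hp.2.1, inner_self_of_mem_S2 hp.1]
  linear_combination -h1 + (sinCoeff lam R R' (halfCos lam ‖p.2‖)) *
    (sinCoeff lam R' R (halfCos lam ‖p.2‖)) * ‖p.2‖ ^ 2 * hε

lemma toPairs_mem (hε : ε ^ 2 = 1) (hR : 0 < R) (hR' : 0 < R') (h : lam ^ 2 = 4 * (R * R'))
    (hp : p ∈ discBundle lam) : toPairs ε lam R R' p ∈ pairs := by
  have hlam : 0 < lam := (norm_nonneg _).trans_lt hp.2.2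
  have h1 := arc_mem_S2 hε hR hR' h hp
  refine ⟨h1, arc_mem_S2 hε hR' hR (by rw [h]; ring) (neg_mem_discBundle hp), fun he => ?_⟩
  have h2 := inner_arc_arc_neg hε hR hR' h hp
  simp only [toPairs] at he
  rw [← he, inner_self_of_mem_S2 h1] at h2
  have := halfCos_pos hlam (norm_mem_Ioo hp.2.2)
  nlinarith

lemma pairCos_toPairs (hε : ε ^ 2 = 1) (hR : 0 < R) (hR' : 0 < R') (h : lam ^ 2 = 4 * (R * R'))
    (hp : p ∈ discBundle lam) : pairCos (toPairs ε lam R R' p) = halfCos lam ‖p.2‖ := by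
  rw [pairCos, toPairs, inner_arc_arc_neg hε hR hR' h hp, ← Real.sqrt_sq halfCos_nonneg]
  congr 1
  ring_nf
  rw [Real.sq_sqrt (sq_nonneg _)]

lemma ofPairs_toPairs (hε : ε ^ 2 = 1) (hR : 0 < R) (hR' : 0 < R') (h : lam ^ 2 = 4 * (R * R'))
    (hp : p ∈ discBundle lam) : ofPairs ε lam R R' (toPairs ε lam R R' p) = p := by
  have hlam : 0 < lam := (norm_nonneg _).trans_lt hp.2.2
  have hk := halfCos_pos hlam (norm_mem_Ioo hp.2.2)
  have h1 := cosCoeff_mul_sinCoeff_add hlam hR hR' h hk.le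
  have hc : lam / (2 * halfCos lam ‖p.2‖) * (2 * halfCos lam ‖p.2‖ / lam) = 1 := by
    field_simp
  simp only [ofPairs, pairCos_toPairs hε hR hR' h hp]
  simp only [toPairs, arc_neg]
  simp only [arc]
  generalize halfCos lam ‖p.2‖ = k at *
  rw [← h1] at hc
  obtain ⟨x, v⟩ := p
  have hv : cross x (cross x v) = -v := by
    rw [cross_cross_right, inner_self_of_mem_S2 hp.1, hp.2.1]; simp
  ext1
  · simp only
    match_scalars
    · linear_combination hc
    · ring
  · simp only [cross_add_left, cross_add_right, cross_smul_left, cross_smul_right, cross_self,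
      ← neg_smul, hv, cross_anticomm x (cross x v)]
    match_scalars
    linear_combination ε ^ 2 * hc + hε

variable {q : E3 × E3}

lemma inner_lt_one_of_mem_pairs (hq : q ∈ pairs) : (inner ℝ q.1 q.2 : ℝ) < 1 :=
  (inner_lt_one_iff_real_of_norm_eq_one (mem_sphere_zero_iff_norm.1 hq.1)
    (mem_sphere_zero_iff_norm.1 hq.2.1)).2 hq.2.2

lemma pairCos_pos (hq : (inner ℝ q.1 q.2 : ℝ) < 1) : 0 < pairCos q :=
  Real.sqrt_pos.2 (by linarith)

lemma inner_eq_of_pairCos (hq : (inner ℝ q.1 q.2 : ℝ) < 1) :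
    (inner ℝ q.1 q.2 : ℝ) = 1 - 2 * pairCos q ^ 2 := by
  rw [pairCos, Real.sq_sqrt (by linarith)]
  ring

lemma norm_sq_ofPairs_snd (hε : ε ^ 2 = 1) (hq : q ∈ pairs) :
    ‖(ofPairs ε lam R R' q).2‖ ^ 2 = lam ^ 2 * (1 - pairCos q ^ 2) := by
  have hlt := inner_lt_one_of_mem_pairs hq
  have hk := pairCos_pos hlt
  have hi := inner_eq_of_pairCos hlt
  rw [← real_inner_self_eq_norm_sq]
  simp only [ofPairs, real_inner_smul_left, real_inner_smul_right, inner_cross_cross]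
  rw [inner_self_of_mem_S2 hq.1, inner_self_of_mem_S2 hq.2.1, real_inner_comm q.1 q.2, hi]
  field_simp
  rw [hε]
  ring

lemma inner_ofPairs_fst_fst (hlam : 0 < lam) (hR : 0 < R) (hR' : 0 < R') (hq : q ∈ pairs) :
    inner ℝ (ofPairs ε lam R R' q).1 q.1 = cosCoeff lam R R' (pairCos q) := by
  have hlt := inner_lt_one_of_mem_pairs hq
  have hk := pairCos_pos hlt
  have hi := inner_eq_of_pairCos hlt
  have h1 := sinCoeff_sub_sinCoeff hlam hR hR' hk.le
  simp only [ofPairs, real_inner_smul_left, inner_sub_left]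
  rw [inner_self_of_mem_S2 hq.1, real_inner_comm q.1 q.2, hi]
  have : sinCoeff lam R' R (pairCos q) * 1 - sinCoeff lam R R' (pairCos q) *
    (1 - 2 * pairCos q ^ 2) = 2 * pairCos q / lam * cosCoeff lam R R' (pairCos q) := by
    linear_combination -h1
  rw [this]
  field_simp

lemma inner_ofPairs_fst_snd (hlam : 0 < lam) (hR : 0 < R) (hR' : 0 < R') (hq : q ∈ pairs) :
    inner ℝ (ofPairs ε lam R R' q).1 q.2 = -cosCoeff lam R' R (pairCos q) := by
  have hlt := inner_lt_one_of_mem_pairs hq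
  have hk := pairCos_pos hlt
  have hi := inner_eq_of_pairCos hlt
  have h1 := sinCoeff_sub_sinCoeff hlam hR' hR hk.le
  simp only [ofPairs, real_inner_smul_left, inner_sub_left]
  rw [inner_self_of_mem_S2 hq.2.1, hi]
  have : sinCoeff lam R' R (pairCos q) * (1 - 2 * pairCos q ^ 2) - sinCoeff lam R R' (pairCos q) *
    1 = -(2 * pairCos q / lam * cosCoeff lam R' R (pairCos q)) := by
    linear_combination h1
  rw [this]
  field_simp

lemma ofPairs_mem (hε : ε ^ 2 = 1) (hlam : 0 < lam) (hR : 0 < R) (hR' : 0 < R')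
    (h : lam ^ 2 = 4 * (R * R')) (hq : q ∈ pairs) : ofPairs ε lam R R' q ∈ discBundle lam := by
  have hk := pairCos_pos (inner_lt_one_of_mem_pairs hq)
  refine ⟨mem_S2_of_inner_self ?_, ?_, ?_⟩
  · have h1 := cosCoeff_mul_sinCoeff_add hlam hR hR' h hk.le
    conv_lhs => rw [ofPairs]
    have h2 := inner_ofPairs_fst_fst (ε := ε) hlam hR hR' hq
    have h3 := inner_ofPairs_fst_snd (ε := ε) hlam hR hR' hq
    have h4 : (inner ℝ (ofPairs ε lam R R' q).1 (ofPairs ε lam R R' q).1 : ℝ) =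
        lam / (2 * pairCos q) * (sinCoeff lam R' R (pairCos q) *
          inner ℝ (ofPairs ε lam R R' q).1 q.1 - sinCoeff lam R R' (pairCos q) *
          inner ℝ (ofPairs ε lam R R' q).1 q.2) := by
      rw [← real_inner_smul_right, ← real_inner_smul_right, ← inner_sub_right,
        ← real_inner_smul_right]
      rfl
    refine h4.trans ?_
    rw [h2, h3]
    have h5 : lam / (2 * pairCos q) * (2 * pairCos q / lam) = 1 := by field_simp
    rw [← h1] at h5
    linear_combination h5
  · simp only [ofPairs, real_inner_smul_left, real_inner_smul_right, inner_sub_left,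
      inner_cross_self_left, inner_cross_self_right]
    ring
  · have := norm_sq_ofPairs_snd (lam := lam) (R := R) (R' := R') hε hq
    refine lt_of_pow_lt_pow_left₀ 2 hlam.le ?_
    rw [this]
    nlinarith [mul_pos (pow_pos hlam 2) (pow_pos hk 2)]

lemma halfCos_ofPairs (hε : ε ^ 2 = 1) (hlam : 0 < lam) (hq : q ∈ pairs) :
    halfCos lam ‖(ofPairs ε lam R R' q).2‖ = pairCos q := by
  have hk := pairCos_pos (inner_lt_one_of_mem_pairs hq)
  rw [halfCos, div_pow, norm_sq_ofPairs_snd hε hq, ← Real.sqrt_sq hk.le]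
  congr 1
  rw [Real.sqrt_sq hk.le]
  field_simp
  ring

lemma cross_ofPairs (hlam : 0 < lam) (hR : 0 < R) (hR' : 0 < R') (hq : q ∈ pairs) :
    cross (ofPairs ε lam R R' q).1 (ofPairs ε lam R R' q).2 =
      (ε * (lam / (2 * pairCos q))) •
        (cosCoeff lam R' R (pairCos q) • q.1 + cosCoeff lam R R' (pairCos q) • q.2) := by
  have h1 : (ofPairs ε lam R R' q).2 = (-(ε * (lam / (2 * pairCos q)))) • cross q.1 q.2 := rfl
  rw [h1, cross_smul_right, cross_cross_right, inner_ofPairs_fst_fst hlam hR hR' hq,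
    inner_ofPairs_fst_snd hlam hR hR' hq]
  module

lemma toPairs_ofPairs (hε : ε ^ 2 = 1) (hlam : 0 < lam) (hR : 0 < R) (hR' : 0 < R')
    (h : lam ^ 2 = 4 * (R * R')) (hq : q ∈ pairs) :
    toPairs ε lam R R' (ofPairs ε lam R R' q) = q := by
  have hk := pairCos_pos (inner_lt_one_of_mem_pairs hq)
  have h1 := cosCoeff_mul_sinCoeff_add hlam hR hR' h hk.le
  have hc : lam / (2 * pairCos q) * (2 * pairCos q / lam) = 1 := by field_simp
  rw [← h1] at hc
  have hfst : (ofPairs ε lam R R' q).1 = (lam / (2 * pairCos q)) •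
      (sinCoeff lam R' R (pairCos q) • q.1 - sinCoeff lam R R' (pairCos q) • q.2) := rfl
  simp only [toPairs, arc_neg]
  simp only [arc, halfCos_ofPairs hε hlam hq, cross_ofPairs hlam hR hR' hq]
  simp only [hfst]
  ext1
  · simp only
    match_scalars
    · linear_combination hc + (sinCoeff lam R R' (pairCos q) * (lam / (2 * pairCos q)) *
        cosCoeff lam R' R (pairCos q)) * hε
    · linear_combination (sinCoeff lam R R' (pairCos q) * (lam / (2 * pairCos q)) *
        cosCoeff lam R R' (pairCos q)) * hε
  · simp only
    match_scalars
    · linear_combination (sinCoeff lam R' R (pairCos q) * (lam / (2 * pairCos q)) *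
        cosCoeff lam R' R (pairCos q)) * hε
    · linear_combination hc + (sinCoeff lam R' R (pairCos q) * (lam / (2 * pairCos q)) *
        cosCoeff lam R R' (pairCos q)) * hε

end Map

/-! ### Smoothness -/

section Smooth

variable {ε lam R R' : ℝ} {p q : E3 × E3} {n : ℕ∞ω}

lemma contDiffAt_halfCos_norm (hp : ‖p.2‖ < lam) :
    ContDiffAt ℝ n (fun q : E3 × E3 => halfCos lam ‖q.2‖) p := by
  have h := one_sub_div_sq_pos ((norm_nonneg _).trans_lt hp) (norm_mem_Ioo hp)
  simp only [halfCos, div_pow] at h ⊢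
  refine ContDiffAt.sqrt ?_ h.ne'
  exact contDiffAt_const.sub ((contDiffAt_snd.norm_sq ℝ).div_const _)

lemma contDiffAt_arc (hR : 0 < R) (hR' : 0 < R') (hp : ‖p.2‖ < lam) :
    ContDiffAt ℝ n (arc ε lam R R') p := by
  have hlam : 0 < lam := (norm_nonneg _).trans_lt hp
  have h1 := (contDiffAt_cosCoeff hlam hR hR' halfCos_nonneg).comp p
    (contDiffAt_halfCos_norm (n := n) hp)
  have h2 := (contDiffAt_sinCoeff hlam hR hR' halfCos_nonneg).comp p
    (contDiffAt_halfCos_norm (n := n) hp)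
  exact (h1.smul contDiffAt_fst).add ((contDiffAt_const.mul h2).smul contDiff_cross.contDiffAt)

lemma contDiffAt_toPairs (hR : 0 < R) (hR' : 0 < R') (hp : ‖p.2‖ < lam) :
    ContDiffAt ℝ n (toPairs ε lam R R') p := by
  refine (contDiffAt_arc hR hR' hp).prodMk ?_
  refine ContDiffAt.comp (g := arc ε lam R' R) (f := fun q => -q) p ?_ contDiffAt_id.neg
  exact contDiffAt_arc hR' hR (by simpa using hp)

lemma contDiffAt_ofPairs (hlam : 0 < lam) (hR : 0 < R) (hR' : 0 < R')
    (hq : (inner ℝ q.1 q.2 : ℝ) < 1) : ContDiffAt ℝ n (ofPairs ε lam R R') q := by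
  have hk := pairCos_pos hq
  have h0 : ContDiffAt ℝ n pairCos q := by
    unfold pairCos
    refine ContDiffAt.sqrt ?_ (by linarith)
    exact (contDiffAt_const.sub (contDiffAt_fst.inner ℝ contDiffAt_snd)).div_const _
  have h1 := (contDiffAt_sinCoeff hlam hR hR' hk.le).comp q h0
  have h2 := (contDiffAt_sinCoeff hlam hR' hR hk.le).comp q h0
  have h3 : ContDiffAt ℝ n (fun q => lam / (2 * pairCos q)) q :=
    contDiffAt_const.div (contDiffAt_const.mul h0) (by positivity)
  exact (h3.smul ((h2.smul contDiffAt_fst).sub (h1.smul contDiffAt_snd))).prodMk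
    ((contDiffAt_const.mul h3).neg.smul contDiff_cross.contDiffAt)

lemma smoothOnSubset_toPairs (hR : 0 < R) (hR' : 0 < R') :
    SmoothOnSubset (toPairs ε lam R R') (discBundle lam) := fun p hp =>
  ⟨{p | ‖p.2‖ < lam}, isOpen_lt (by fun_prop) (by fun_prop), hp.2.2, _,
    fun _ hq => (contDiffAt_toPairs hR hR' hq).contDiffWithinAt, fun _ _ => rfl⟩

lemma smoothOnSubset_ofPairs (hlam : 0 < lam) (hR : 0 < R) (hR' : 0 < R') :
    SmoothOnSubset (ofPairs ε lam R R') pairs := fun q hq =>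
  ⟨{q | (inner ℝ q.1 q.2 : ℝ) < 1}, isOpen_lt (by fun_prop) (by fun_prop),
    inner_lt_one_of_mem_pairs hq, _,
    fun _ hq => (contDiffAt_ofPairs hlam hR hR' hq).contDiffWithinAt, fun _ _ => rfl⟩

end Smooth

/-! ### Equivariance and the moment maps -/

section Equivariance

variable {ε lam R R' : ℝ} {p : E3 × E3}

lemma act_neg (A : SO3) (p : E3 × E3) : act A (-p) = -act A p := by
  have h : ∀ u : E3, rotate A (-u) = -rotate A u := fun u => by
    rw [← neg_one_smul ℝ u, rotate_smul, neg_one_smul]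
  simp [act, h]

lemma arc_act (A : SO3) (p : E3 × E3) : arc ε lam R R' (act A p) = rotate A (arc ε lam R R' p) := by
  simp only [arc, act, norm_rotate, cross_rotate, rotate_add, rotate_smul]

lemma toPairs_act (A : SO3) (p : E3 × E3) :
    toPairs ε lam R R' (act A p) = act A (toPairs ε lam R R' p) := by
  rw [toPairs, ← act_neg, arc_act, arc_act]
  rfl

lemma pairsMoment_toPairs (hε : ε ^ 2 = 1) (hR : 0 < R) (hR' : 0 < R')
    (h : lam ^ 2 = 4 * (R * R')) (hp : ‖p.2‖ < lam) :
    pairsMoment ε R R' (toPairs ε lam R R' p) = discMoment ε (R' - R) p := by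
  have hlam : 0 < lam := (norm_nonneg _).trans_lt hp
  have h1 := cosCoeff_balance hlam hR hR' (halfCos_nonneg (lam := lam) (r := ‖p.2‖))
  have h2 := sinCoeff_balance hlam hR hR' h (halfCos_nonneg (lam := lam) (r := ‖p.2‖))
  simp only [pairsMoment, toPairs, arc_neg, discMoment]
  simp only [arc]
  match_scalars
  · linear_combination ε * h1
  · linear_combination ε ^ 2 * h2 + hε

end Equivariance

/-! ### The derivative of the map -/

section Derivative

variable {ε lam R R' : ℝ} {p a : E3 × E3} {L : E3 × E3 →L[ℝ] E3}

/-- The derivative of a function of `halfCos lam ‖v‖` only depends on `⟨v, a.2⟩`; in particular it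
vanishes at `v = 0`, where the norm is not differentiable. -/
lemma exists_hasFDerivAt_radial {φ : ℝ → ℝ} (hφ : DifferentiableAt ℝ φ (halfCos lam ‖p.2‖))
    (hp : ‖p.2‖ < lam) :
    ∃ d : ℝ, HasFDerivAt (fun q : E3 × E3 => φ (halfCos lam ‖q.2‖))
      (d • (innerSL ℝ p.2).comp (ContinuousLinearMap.snd ℝ E3 E3)) p := by
  have h := one_sub_div_sq_pos ((norm_nonneg _).trans_lt hp) (norm_mem_Ioo hp)
  simp only [halfCos, div_pow] at h hφ ⊢
  have h1 : DifferentiableAt ℝ (fun t : ℝ => φ √(1 - t / lam ^ 2)) (‖p.2‖ ^ 2) := by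
    refine DifferentiableAt.comp (f := fun t : ℝ => √(1 - t / lam ^ 2)) (‖p.2‖ ^ 2) hφ ?_
    exact DifferentiableAt.sqrt (by fun_prop) h.ne'
  have h2 : HasFDerivAt (fun q : E3 × E3 => ‖q.2‖ ^ 2)
      (2 • (innerSL ℝ p.2).comp (ContinuousLinearMap.snd ℝ E3 E3)) p := hasFDerivAt_snd.norm_sq
  refine ⟨deriv (fun t : ℝ => φ √(1 - t / lam ^ 2)) (‖p.2‖ ^ 2) * 2, ?_⟩
  refine (h1.hasDerivAt.comp_hasFDerivAt p h2).congr_fderiv ?_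
  rw [mul_smul, two_smul ℝ, two_nsmul]

lemma exists_hasFDerivAt_arc (hR : 0 < R) (hR' : 0 < R') (hp : ‖p.2‖ < lam) :
    ∃ (d e : ℝ) (L : E3 × E3 →L[ℝ] E3), HasFDerivAt (arc ε lam R R') L p ∧ ∀ a, L a =
      cosCoeff lam R R' (halfCos lam ‖p.2‖) • a.1 + (d * inner ℝ p.2 a.2) • p.1 +
      ((ε * sinCoeff lam R R' (halfCos lam ‖p.2‖)) • (cross p.1 a.2 + cross a.1 p.2) +
        (ε * (e * inner ℝ p.2 a.2)) • cross p.1 p.2) := by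
  have hlam : 0 < lam := (norm_nonneg _).trans_lt hp
  obtain ⟨d, hd⟩ := exists_hasFDerivAt_radial
    ((contDiffAt_cosCoeff hlam hR hR' halfCos_nonneg (n := 1)).differentiableAt one_ne_zero) hp
  obtain ⟨e, he⟩ := exists_hasFDerivAt_radial
    ((contDiffAt_sinCoeff hlam hR hR' halfCos_nonneg (n := 1)).differentiableAt one_ne_zero) hp
  exact ⟨d, e, _, (hd.smul hasFDerivAt_fst).add ((he.const_mul ε).smul (hasFDerivAt_cross p)),
    fun a => rfl⟩

/-- The infinitesimal form of equivariance. -/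
lemma arcDeriv_generator (hR : 0 < R) (hR' : 0 < R') (hp : ‖p.2‖ < lam)
    (hL : HasFDerivAt (arc ε lam R R') L p) (ξ : E3) :
    L (generator ξ p) = cross ξ (arc ε lam R R' p) := by
  obtain ⟨d, e, L', hL', h⟩ := exists_hasFDerivAt_arc (ε := ε) hR hR' hp
  rw [hL.unique hL', h]
  simp only [generator, inner_cross_self_right, mul_zero, zero_smul, add_zero, arc,
    cross_add_right, cross_smul_right]
  rw [cross_jacobi ξ p.1 p.2, add_comm (cross (cross ξ p.1) p.2)]

lemma arcDeriv_vertical_of_zero (hR : 0 < R) (hR' : 0 < R') (hlam : 0 < lam) (hp : p.2 = 0)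
    (hL : HasFDerivAt (arc ε lam R R') L p) (w : E3) :
    L (0, w) = (ε * sinCoeff lam R R' 1) • cross p.1 w := by
  obtain ⟨d, e, L', hL', h⟩ := exists_hasFDerivAt_arc (ε := ε) (lam := lam) hR hR'
    (p := p) (by simpa [hp] using hlam)
  rw [hL.unique hL', h]
  simp [hp, halfCos_zero, ← crossBilin_apply]

lemma inner_arcDeriv (hε : ε ^ 2 = 1) (hR : 0 < R) (hR' : 0 < R') (h : lam ^ 2 = 4 * (R * R'))
    (hp : p ∈ discBundle lam) (ha : inner ℝ p.1 a.1 = (0 : ℝ))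
    (hL : HasFDerivAt (arc ε lam R R') L p) :
    inner ℝ (arc ε lam R R' p) (L a) = (0 : ℝ) := by
  have hlam : 0 < lam := (norm_nonneg _).trans_lt hp.2.2
  obtain ⟨d, hd⟩ := exists_hasFDerivAt_radial
    ((contDiffAt_sinCoeff hlam hR hR' halfCos_nonneg (n := 1)).differentiableAt one_ne_zero) hp.2.2
  have h1 := hL.norm_sq
  have h2 := (hasFDerivAt_fst (𝕜 := ℝ) (E := E3) (F := E3) (p := p)).norm_sq.sub
    ((hd.mul ((hasFDerivAt_fst (𝕜 := ℝ) (E := E3) (F := E3) (p := p)).inner ℝ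
      (hasFDerivAt_snd (𝕜 := ℝ) (E := E3) (F := E3) (p := p)))).pow 2)
  have h3 : (fun q => ‖arc ε lam R R' q‖ ^ 2) =ᶠ[nhds p] fun q : E3 × E3 => ‖q.1‖ ^ 2 -
      (sinCoeff lam R R' (halfCos lam ‖q.2‖) * inner ℝ q.1 q.2 : ℝ) ^ 2 := by
    have hopen : IsOpen {q : E3 × E3 | ‖q.2‖ < lam} := isOpen_lt (by fun_prop) (by fun_prop)
    filter_upwards [hopen.mem_nhds hp.2.2] with q hq
    rw [← real_inner_self_eq_norm_sq, inner_arc_self hε hR hR' h hq, real_inner_self_eq_norm_sq]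
  have h4 := congrArg (fun l : E3 × E3 →L[ℝ] ℝ => l a) (h1.unique (h2.congr_of_eventuallyEq h3))
  simpa [hp.2.1, ha] using h4

end Derivative

/-! ### The pullback of the split form -/

/-- Two skew-symmetric biadditive forms agree on `g + e` and `g' + e'` if they agree whenever one of
the arguments is `g` or `g'`, and on `e` and `e'`. -/
lemma forms_eq_of_summands {V : Type*} [AddCommGroup V] {P T : V → V → ℝ}
    (hP : ∀ a b c, P (a + b) c = P a c + P b c) (hP' : ∀ a b, P b a = -P a b)
    (hT : ∀ a b c, T (a + b) c = T a c + T b c) (hT' : ∀ a b, T b a = -T a b)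
    {g e g' e' : V} (h₁ : P g (g' + e') = T g (g' + e')) (h₂ : P g' e = T g' e)
    (h₃ : P e e' = T e e') : P (g + e) (g' + e') = T (g + e) (g' + e') := by
  rw [hP, hT, h₁, hP' (g' + e') e, hT' (g' + e') e, hP, hT, h₂, hP' e e', hT' e e', h₃]

section Forms

variable {ε s R R' : ℝ} {p q : E3 × E3}

lemma area_add_left (x a b c : E3) : area ε x (a + b) c = area ε x a c + area ε x b c := by
  simp only [area, iota, cross_add_left, smul_add, inner_add_left]

lemma area_swap (x a b : E3) : area ε x b a = -area ε x a b := by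
  simp only [area, iota, real_inner_smul_left, inner_eq_coords, cross_apply_zero, cross_apply_one,
    cross_apply_two]
  ring

lemma area_smul_smul (x a b : E3) (c d : ℝ) :
    area ε x (c • a) (d • b) = c * d * area ε x a b := by
  simp only [area, iota, cross_smul_left, real_inner_smul_left, real_inner_smul_right]
  ring

lemma area_neg (x a b : E3) : area ε (-x) a b = -area ε x a b := by
  rw [area, iota, ← neg_one_smul ℝ x, cross_smul_right, smul_comm, ← iota, real_inner_smul_left,
    neg_one_mul, area]

lemma area_self (x a : E3) : area ε x a a = 0 := by
  linarith [area_swap (ε := ε) x a a]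

lemma splitForm_add_left (a b c : E3 × E3) :
    splitForm ε R R' q (a + b) c = splitForm ε R R' q a c + splitForm ε R R' q b c := by
  simp only [splitForm, Prod.fst_add, Prod.snd_add, area_add_left]
  ring

lemma splitForm_swap (a b : E3 × E3) : splitForm ε R R' q b a = -splitForm ε R R' q a b := by
  rw [splitForm, area_swap, area_swap q.2]
  simp only [splitForm]
  ring

lemma twistedForm_add_left (a b c : E3 × E3) :
    twistedForm ε s p (a + b) c = twistedForm ε s p a c + twistedForm ε s p b c := by
  simp only [twistedForm_eq, Prod.fst_add, Prod.snd_add, cross_add_left, inner_add_left,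
    inner_add_right]
  ring

lemma twistedForm_swap (a b : E3 × E3) : twistedForm ε s p b a = -twistedForm ε s p a b := by
  simp only [twistedForm, extDeriv_canonicalForm, area_swap p.1 a.1 b.1]
  ring

lemma twistedForm_vertical (v w : E3) : twistedForm ε s p (0, v) (0, w) = 0 := by
  simp [twistedForm_eq]

/-- A tangent vector of the disc bundle is the sum of an infinitesimal rotation and a vertical
vector. -/
lemma exists_generator_add {a : E3 × E3} (hp : p.1 ∈ S2) (ha : inner ℝ p.1 a.1 = (0 : ℝ)) :
    ∃ ξ w : E3, a = generator ξ p + (0, w) := by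
  refine ⟨cross p.1 a.1, a.2 - cross (cross p.1 a.1) p.2, ?_⟩
  ext1
  · simp [generator, cross_cross_left, mem_sphere_zero_iff_norm.1 hp, real_inner_comm p.1, ha]
  · simp [generator]

/-- Outside the zero section the vertical vector can be chosen radial. -/
lemma exists_generator_add_smul {a : E3 × E3} (hp : p.1 ∈ S2) (hpp : inner ℝ p.1 p.2 = (0 : ℝ))
    (hp0 : p.2 ≠ 0) (ha : a ∈ discTangent p) :
    ∃ (ξ : E3) (t : ℝ), a = generator ξ p + (0, t • p.2) := by
  have h1 := inner_self_of_mem_S2 hp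
  obtain ⟨x, v⟩ := p
  obtain ⟨a, b⟩ := a
  obtain ⟨ha, hb⟩ := ha
  simp only at *
  have hv : (inner ℝ v v : ℝ) ≠ 0 := inner_self_ne_zero.2 hp0
  refine ⟨cross x a + (inner ℝ (cross x v) b / inner ℝ v v : ℝ) • x,
    inner ℝ v b / inner ℝ v v, ?_⟩
  ext1
  · simp [generator, cross_add_left, cross_smul_left, cross_self, cross_cross_left,
      mem_sphere_zero_iff_norm.1 hp, ha, real_inner_comm x a]
  · -- the coordinates of `b` in the orthogonal basis `x`, `v`, `x × v`
    have hbasis : (inner ℝ v v : ℝ) • b = (inner ℝ v v * inner ℝ x b : ℝ) • x +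
        (inner ℝ v b : ℝ) • v + (inner ℝ (cross x v) b : ℝ) • cross x v := by
      have e1 : cross (cross (cross x v) b) (cross x v) =
          (inner ℝ v v : ℝ) • b - (inner ℝ (cross x v) b : ℝ) • cross x v := by
        rw [cross_cross_left, inner_cross_cross, hpp, h1, real_inner_comm (cross x v) b]
        simp
      have e2 : cross (cross x v) b = (inner ℝ x b : ℝ) • v - (inner ℝ v b : ℝ) • x :=
        cross_cross_left x v b
      rw [← sub_eq_iff_eq_add, ← e1, e2, sub_eq_add_neg, cross_add_left, ← neg_smul,
        cross_smul_left, cross_smul_left, cross_cross_right, cross_cross_right, hpp, h1,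
        real_inner_comm x v, hpp]
      module
    have hb' : b = (inner ℝ v v : ℝ)⁻¹ • ((inner ℝ v v : ℝ) • b) := by
      rw [smul_smul, inv_mul_cancel₀ hv, one_smul]
    have hxb : (inner ℝ x b : ℝ) = -inner ℝ a v := by linarith
    simp only [generator, Prod.snd_add, cross_add_left, cross_smul_left, cross_cross_left, hpp]
    conv_lhs => rw [hb', hbasis, hxb]
    match_scalars
    · field_simp
    · field_simp
    · field_simp
    · ring

end Forms

section Pullback

variable {ε lam R R' : ℝ} {p : E3 × E3} {L : E3 × E3 →L[ℝ] E3 × E3}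

lemma hasFDerivAt_fst_toPairs (hL : HasFDerivAt (toPairs ε lam R R') L p) :
    HasFDerivAt (arc ε lam R R') ((ContinuousLinearMap.fst ℝ E3 E3).comp L) p :=
  hL.fst

lemma hasFDerivAt_snd_toPairs (hL : HasFDerivAt (toPairs ε lam R R') L p) :
    HasFDerivAt (arc ε lam R' R)
      (-(ContinuousLinearMap.snd ℝ E3 E3).comp L) (-p) := by
  have h1 : HasFDerivAt (fun q => arc ε lam R' R (-q)) ((ContinuousLinearMap.snd ℝ E3 E3).comp L)
    p := hL.snd
  have h2 := HasFDerivAt.comp (g := fun q => arc ε lam R' R (-q)) (f := fun q : E3 × E3 => -q) (-p)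
    (by simpa using h1) (hasFDerivAt_id (-p)).neg
  refine (h2.congr_fderiv ?_).congr_of_eventuallyEq (Filter.Eventually.of_forall fun q => ?_)
  · ext <;> simp
  · simp

lemma toPairsDeriv_generator (hR : 0 < R) (hR' : 0 < R') (hp : ‖p.2‖ < lam)
    (hL : HasFDerivAt (toPairs ε lam R R') L p) (ξ : E3) :
    L (generator ξ p) = generator ξ (toPairs ε lam R R' p) := by
  have h1 := arcDeriv_generator hR hR' hp (hasFDerivAt_fst_toPairs hL) ξ
  have h2 := arcDeriv_generator hR' hR (by simpa using hp) (hasFDerivAt_snd_toPairs hL) ξ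
  have h3 : generator ξ (-p) = -generator ξ p := by
    simp [generator, ← crossBilin_apply]
  ext1
  · exact h1
  · have h4 : (L (generator ξ p)).2 = cross ξ (arc ε lam R' R (-p)) := by simpa [h3] using h2
    exact h4

lemma toPairsDeriv_mem (hε : ε ^ 2 = 1) (hR : 0 < R) (hR' : 0 < R') (h : lam ^ 2 = 4 * (R * R'))
    (hp : p ∈ discBundle lam) (hL : HasFDerivAt (toPairs ε lam R R') L p) {a : E3 × E3}
    (ha : a ∈ discTangent p) : L a ∈ pairsTangent (toPairs ε lam R R' p) := by
  refine ⟨inner_arcDeriv hε hR hR' h hp ha.1 (hasFDerivAt_fst_toPairs hL), ?_⟩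
  have := inner_arcDeriv (a := a) hε hR' hR (by rw [h]; ring) (neg_mem_discBundle hp)
    (by simp [ha.1]) (hasFDerivAt_snd_toPairs hL)
  have h1 : inner ℝ (arc ε lam R' R (-p)) (L a).2 = (0 : ℝ) := by simpa using this
  exact h1

lemma pairsMoment_toPairsDeriv (hε : ε ^ 2 = 1) (hR : 0 < R) (hR' : 0 < R')
    (h : lam ^ 2 = 4 * (R * R')) (hp : ‖p.2‖ < lam) (hL : HasFDerivAt (toPairs ε lam R R') L p)
    (a : E3 × E3) : pairsMoment ε R R' (L a) = discMomentDeriv ε (R' - R) p a := by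
  have h1 := (hasFDerivAt_pairsMoment ε R R' _).comp p hL
  have h2 : pairsMoment ε R R' ∘ toPairs ε lam R R' =ᶠ[nhds p] discMoment ε (R' - R) := by
    have hopen : IsOpen {q : E3 × E3 | ‖q.2‖ < lam} := isOpen_lt (by fun_prop) (by fun_prop)
    filter_upwards [hopen.mem_nhds hp] with q hq using pairsMoment_toPairs hε hR hR' h hq
  exact congrArg (fun l : E3 × E3 →L[ℝ] E3 => l a)
    (h1.unique ((hasFDerivAt_discMoment ε (R' - R) p).congr_of_eventuallyEq h2))

/-- Because the map intertwines actions and moment maps, the pulled back form and the twisted form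
agree as soon as one argument is an infinitesimal rotation. -/
lemma splitForm_toPairsDeriv_generator (hε : ε ^ 2 = 1) (hR : 0 < R) (hR' : 0 < R')
    (h : lam ^ 2 = 4 * (R * R')) (hp : p ∈ discBundle lam)
    (hL : HasFDerivAt (toPairs ε lam R R') L p) {a : E3 × E3} (ha : a ∈ discTangent p) (ξ : E3) :
    splitForm ε R R' (toPairs ε lam R R' p) (L (generator ξ p)) (L a) =
      twistedForm ε (R' - R) p (generator ξ p) a := by
  have hq := toPairs_mem hε hR hR' h hp
  rw [toPairsDeriv_generator hR hR' hp.2.2 hL, splitForm_generator hq.1 hq.2.1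
    (toPairsDeriv_mem hε hR hR' h hp hL ha), twistedForm_generator hp.1 ha.1,
    pairsMoment_toPairsDeriv hε hR hR' h hp.2.2 hL]

/-- On the zero section the pulled back form vanishes on vertical vectors. -/
lemma splitForm_toPairsDeriv_vertical (hR : 0 < R) (hR' : 0 < R')
    (hlam : 0 < lam) (h : lam ^ 2 = 4 * (R * R')) (hp : p.2 = 0)
    (hL : HasFDerivAt (toPairs ε lam R R') L p) (v w : E3) :
    splitForm ε R R' (toPairs ε lam R R' p) (L (0, v)) (L (0, w)) = 0 := by
  have h1 : ∀ w, (L (0, w)).1 = (ε * sinCoeff lam R R' 1) • cross p.1 w :=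
    arcDeriv_vertical_of_zero hR hR' hlam hp (hasFDerivAt_fst_toPairs hL)
  have h2 : ∀ w, (L (0, w)).2 = (ε * sinCoeff lam R' R 1) • cross p.1 w := fun w => by
    have := arcDeriv_vertical_of_zero hR' hR hlam (by simpa using hp)
      (hasFDerivAt_snd_toPairs hL) (-w)
    have hneg : ((0 : E3), -w) = -(0, w) := by simp
    rw [hneg, map_neg, Prod.fst_neg, cross_neg_neg] at this
    simpa using this
  have h3 : toPairs ε lam R R' p = (p.1, -p.1) := by
    simp [toPairs, arc, hp, halfCos_zero, cosCoeff_one hlam hR hR', cosCoeff_one hlam hR' hR,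
      ← crossBilin_apply]
  simp only [splitForm, h1, h2, h3, area_smul_smul, area_neg]
  linear_combination ε ^ 2 * area ε p.1 (cross p.1 v) (cross p.1 w) *
    sinCoeff_one_sq hlam hR hR' h

lemma splitForm_toPairsDeriv (hε : ε ^ 2 = 1) (hR : 0 < R) (hR' : 0 < R')
    (h : lam ^ 2 = 4 * (R * R')) (hp : p ∈ discBundle lam)
    (hL : HasFDerivAt (toPairs ε lam R R') L p) {a b : E3 × E3} (ha : a ∈ discTangent p)
    (hb : b ∈ discTangent p) :
    splitForm ε R R' (toPairs ε lam R R' p) (L a) (L b) = twistedForm ε (R' - R) p a b := by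
  have hlam : 0 < lam := (norm_nonneg _).trans_lt hp.2.2
  have key : ∀ {ξ η v w : E3}, a = generator ξ p + (0, v) → b = generator η p + (0, w) →
      inner ℝ p.1 v = (0 : ℝ) →
      splitForm ε R R' (toPairs ε lam R R' p) (L (0, v)) (L (0, w)) = 0 →
      splitForm ε R R' (toPairs ε lam R R' p) (L a) (L b) = twistedForm ε (R' - R) p a b := by
    rintro ξ η v w rfl rfl hv h0
    refine forms_eq_of_summands
      (P := fun a b => splitForm ε R R' (toPairs ε lam R R' p) (L a) (L b))
      (T := twistedForm ε (R' - R) p)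
      (fun a b c => by simp only [map_add, splitForm_add_left]) (fun a b => splitForm_swap _ _)
      twistedForm_add_left twistedForm_swap
      (splitForm_toPairsDeriv_generator hε hR hR' h hp hL hb ξ)
      (splitForm_toPairsDeriv_generator hε hR hR' h hp hL ⟨by simp, by simpa using hv⟩ η) ?_
    rw [twistedForm_vertical, ← h0]
  rcases eq_or_ne p.2 0 with h0 | h0
  · obtain ⟨ξ, v, hv⟩ := exists_generator_add hp.1 ha.1
    obtain ⟨η, w, hw⟩ := exists_generator_add hp.1 hb.1
    refine key hv hw ?_ (splitForm_toPairsDeriv_vertical hR hR' hlam h h0 hL v w)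
    have h1 := ha.2
    rw [hv] at h1
    simpa [generator, h0, ← crossBilin_apply] using h1
  · obtain ⟨ξ, t, ht⟩ := exists_generator_add_smul hp.1 hp.2.1 h0 ha
    obtain ⟨η, u, hu⟩ := exists_generator_add_smul hp.1 hp.2.1 h0 hb
    refine key ht hu (by rw [real_inner_smul_right, hp.2.1, mul_zero]) ?_
    have hL' : ∀ t : ℝ, L (0, t • p.2) = t • L (0, p.2) := fun t => by
      rw [← map_smul, Prod.smul_mk, smul_zero]
    simp only [hL', splitForm, Prod.smul_fst, Prod.smul_snd, area_smul_smul, area_self]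
    ring

lemma isSymplectomorphism_toPairs (hε : ε ^ 2 = 1) (hlam : 0 < lam) (hR : 0 < R) (hR' : 0 < R')
    (h : lam ^ 2 = 4 * (R * R')) :
    IsSymplectomorphism (discBundle lam) discTangent (twistedForm ε (R' - R))
      pairs pairsTangent (splitForm ε R R') (toPairs ε lam R R') := by
  have hinv : Set.InvOn (ofPairs ε lam R R') (toPairs ε lam R R') (discBundle lam) pairs :=
    ⟨fun p hp => ofPairs_toPairs hε hR hR' h hp, fun q hq => toPairs_ofPairs hε hlam hR hR' h hq⟩
  refine ⟨hinv.bijOn (fun p hp => toPairs_mem hε hR hR' h hp)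
    (fun q hq => ofPairs_mem hε hlam hR hR' h hq), smoothOnSubset_toPairs hR hR',
    ⟨_, smoothOnSubset_ofPairs hlam hR hR', hinv⟩, fun p hp => ?_⟩
  have hL := ((contDiffAt_toPairs (ε := ε) (n := 1) hR hR' hp.2.2).differentiableAt
    one_ne_zero).hasFDerivAt
  exact ⟨_, hL.hasFDerivWithinAt, fun a ha => toPairsDeriv_mem hε hR hR' h hp hL ha,
    fun a ha b hb => splitForm_toPairsDeriv hε hR hR' h hp hL ha hb⟩

/-- At `p` this gives the first component of `toPairs`, at `-p` (with exchanged weights) the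
second. -/
lemma isGeodesicPoint_arc (hε : ε ^ 2 = 1) (hR : 0 < R) (hR' : 0 < R')
    (h : lam ^ 2 = 4 * (R * R')) (hp : p ∈ discBundle lam) :
    IsGeodesicPoint p.1 (-iota ε p.1 p.2) (time lam R R' ‖p.2‖) (arc ε lam R R' p) := by
  have hlam : 0 < lam := (norm_nonneg _).trans_lt hp.2.2
  have hr := norm_mem_Ioo hp.2.2
  have hw : -iota ε p.1 p.2 = ε • cross p.1 p.2 := by
    rw [iota, cross_anticomm p.1 p.2, smul_neg, neg_neg]
  have hnorm : ‖-iota ε p.1 p.2‖ = ‖p.2‖ := by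
    rw [← sq_eq_sq₀ (norm_nonneg _) (norm_nonneg _), hw, ← real_inner_self_eq_norm_sq,
      ← real_inner_self_eq_norm_sq, real_inner_smul_left, real_inner_smul_right, inner_cross_cross,
      inner_self_of_mem_S2 hp.1, hp.2.1]
    linear_combination (inner ℝ p.2 p.2 : ℝ) * hε
  convert isGeodesicPoint_greatCircle hp.1 (w := -iota ε p.1 p.2) ?_ (time lam R R' ‖p.2‖) using 1
  · rw [hnorm, time_mul_self, cos_angle hlam hR hR' h hr, sin_angle hlam hR hR' h hr, arc, hw]
    rcases eq_or_ne p.2 0 with h0 | h0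
    · simp [h0, ← crossBilin_apply]
    · rw [mul_div_cancel_right₀ _ (norm_ne_zero_iff.2 h0), smul_smul, mul_comm ε]
  · rw [hw, real_inner_smul_right, inner_cross_self_left, mul_zero]

end Pullback

end MagneticSphere

open MagneticSphere
theorem theorem2 (s lam ε : ℝ) (hlam : 0 < lam) (hε : ε = 1 ∨ ε = -1) :
    (∃! R : ℝ × ℝ, 0 < R.1 ∧ 0 < R.2 ∧ s = R.2 - R.1 ∧ lam = 2 * √(R.1 * R.2)) ∧
    IsMomentMap (discBundle lam) discTangent (twistedForm ε s) (discMoment ε s) ∧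
    ∀ R₁ R₂ : ℝ, 0 < R₁ → 0 < R₂ → s = R₂ - R₁ → lam = 2 * √(R₁ * R₂) →
      IsMomentMap pairs pairsTangent (splitForm ε R₁ R₂) (pairsMoment ε R₁ R₂) ∧
      ∃ (F : E3 × E3 → E3 × E3) (c₁ c₂ : ℝ → ℝ),
        -- `F` is an equivariant symplectomorphism
        IsSymplectomorphism (discBundle lam) discTangent (twistedForm ε s)
          pairs pairsTangent (splitForm ε R₁ R₂) F ∧
        (∀ A : SO3, ∀ p ∈ discBundle lam, F (act A p) = act A (F p)) ∧
        -- it intertwines the moment maps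
        (∀ p ∈ discBundle lam, pairsMoment ε R₁ R₂ (F p) = discMoment ε s p) ∧
        -- the times are smooth, even and positive, and satisfy the trigonometric equations
        ContDiffOn ℝ ∞ c₁ (Set.Ioo (-lam) lam) ∧
        ContDiffOn ℝ ∞ c₂ (Set.Ioo (-lam) lam) ∧
        (∀ r ∈ Set.Ioo (-lam) lam,
          0 < c₁ r ∧ 0 < c₂ r ∧ c₁ (-r) = c₁ r ∧ c₂ (-r) = c₂ r ∧
          R₁ * Real.sin (c₁ r * r) + R₂ * Real.sin (c₂ r * r) = r ∧
          R₁ * Real.cos (c₁ r * r) - R₂ * Real.cos (c₂ r * r) = R₁ - R₂) ∧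
        -- the two components of `F` are built from the geodesic flow
        ∀ p ∈ discBundle lam,
          IsGeodesicPoint p.1 (-iota ε p.1 p.2) (c₁ ‖p.2‖) (F p).1 ∧
          IsGeodesicPoint (-p.1) (-iota ε (-p.1) (-p.2)) (c₂ ‖p.2‖) (F p).2 := by
  refine ⟨existsUnique_radii hlam, isMomentMap_discMoment ε s lam, ?_⟩
  rintro R₁ R₂ hR₁ hR₂ rfl hlamR
  have hε2 : ε ^ 2 = 1 := by rcases hε with rfl | rfl <;> norm_num
  have h : lam ^ 2 = 4 * (R₁ * R₂) := by
    rw [hlamR, mul_pow, Real.sq_sqrt (by positivity)]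
    norm_num
  have h' : lam ^ 2 = 4 * (R₂ * R₁) := by rw [h, mul_comm R₁]
  refine ⟨isMomentMap_pairsMoment ε R₁ R₂, toPairs ε lam R₁ R₂, time lam R₁ R₂, time lam R₂ R₁,
    isSymplectomorphism_toPairs hε2 hlam hR₁ hR₂ h, fun A p _ => toPairs_act A p,
    fun p hp => pairsMoment_toPairs hε2 hR₁ hR₂ h hp.2.2, contDiffOn_time hlam hR₁ hR₂,
    contDiffOn_time hlam hR₂ hR₁, fun r hr => ⟨time_pos hlam hR₁ hR₂ h hr,
      time_pos hlam hR₂ hR₁ h' hr, time_neg, time_neg, ?_, ?_⟩, fun p hp => ⟨?_, ?_⟩⟩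
  · rw [time_mul_self, time_mul_self, sin_angle hlam hR₁ hR₂ h hr, sin_angle hlam hR₂ hR₁ h' hr]
    linear_combination r * sinCoeff_balance hlam hR₁ hR₂ h (halfCos_nonneg (lam := lam) (r := r))
  · rw [time_mul_self, time_mul_self, cos_angle hlam hR₁ hR₂ h hr, cos_angle hlam hR₂ hR₁ h' hr]
    exact cosCoeff_balance hlam hR₁ hR₂ halfCos_nonneg
  · exact isGeodesicPoint_arc hε2 hR₁ hR₂ h hp
  · simpa [toPairs] using isGeodesicPoint_arc hε2 hR₂ hR₁ h' (neg_mem_discBundle hp)
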